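/- **Setting.** Consider minimizing $\Phi(x)=f(g(x))+h(x)$ over $x\in\mathbb R^n$, where $f:\mathbb R^m\to\mathbb R$ is convex and $l_f$-Lipschitz, $h:\mathbb R^n\to\mathbb R\cup\{+\infty\}$ is closed, convex and proper, and $g(x)=\mathbb E_{\xi\sim D}[g_\xi(x)]$ is differentiable and $l_g$-Lipschitz with Jacobian $g'$ that is $L_g$-Lipschitz in operator norm. The $g_\xi:\mathbb R^n\to\mathbb R^m$ are differentiable, values and Jacobians being measurable in $(\xi,x)$. Assume that for $D$-almost every $\xi$ and all $x,y$: $\|g_\xi(x)-g(x)\|_2\le\sigma_g$, $\|g_\xi'(x)-g'(x)\|_{\rm op}\le\sigma_{g'}$, $\|g_\xi(x)-g_\xi(y)\|_2\le\widehat l_g\|x-y\|_2$, $\|g'_\xi(x)-g'_\xi(y)\|_{\rm op}\le\widehat L_g\|x-y\|_2$. Let $\Phi^*=\inf\Phi>-\infty$, $\Phi(x_0^0)-\Phi^*\le\Gamma<\infty$ and $M>5l_fL_g$. The generalized gradient is $\mathcal G_M(x)=M(x-x_+)$ with $x_+=\operatorname{argmin}_y\{f(g(x)+g'(x)(y-x))+h(y)+\frac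 M2\|y-x\|_2^2\}$. **Algorithm.** Given $K$, $\tau_0,\dots,\tau_{K-1}$, batch sizes $A,B,a,b$ and tolerances $\overline\epsilon,\overline\delta$: for $k=0,\dots,K-1$ and $i=0,\dots,\tau_k-1$ compute $$\widetilde g_0^k=\tfrac1A\sum_{\xi\in\mathcal A_0^k}g_\xi(x_0^k),\quad \widetilde J_0^k=\tfrac1B\sum_{\xi\in\mathcal B_0^k}g'_\xi(x_0^k),$$ and for $i>0$ $$\widetilde g_i^k=\tfrac1a\sum_{\xi\in\mathcal A_i^k}\bigl(g_\xi(x_i^k)-g_\xi(x_0^k)\bigr)+\widetilde g_0^k,\quad \widetilde J_i^k=\tfrac1b\sum_{\xi\in\mathcal B_i^k}\bigl(g'_\xi(x_i^k)-g'_\xi(x_0^k)\bigr)+\widetilde J_0^k,$$ all batches being i.i.d. samples from $D$ of sizes $|\mathcal A_0^k|=A$, $|\mathcal B_0^k|=B$, $|\mathcal A_i^k|=a$, $|\mathcal B_i^k|=b$ $(i>0)$; then let $x_{i+1}^k$ be the output of a randomized solver (with fresh independent randomness, measurable in the subproblem data and the randomness) applied to $s_i^k(y)=f(\widetilde g_i^k+\widetilde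 J_i^k(y-x_i^k))+h(y)+\frac M2\|y-x_i^k\|_2^2$. After epoch $k$ set $x_0^{k+1}=x_{\tau_k}^k$. For all tolerances $\overline\epsilon,\overline\delta>0$ the solver returns, on each such subproblem $s$, with probability at least $1-\overline\delta$ a point $y$ with $s(y)\le\inf s+\overline\epsilon$. The evaluation (Jacobian) complexity is the number of evaluations of components $g_\xi$ (of Jacobians $g'_\xi$): $A$ (resp. $B$) at iterations $(k,0)$ and $2a$ (resp. $2b$) at iterations $(k,i)$, $i>0$. **Random epoch lengths.** Let $D_\tau(\cdot;\tau_+,\theta_\tau)$, $\tau_+\in\mathbb N_+$, $\theta_\tau\in\Theta_\tau$, be laws supported in $\{1,\dots,\tau_+\}$ such that $C_\tau$ times the mean of $D_\tau(\cdot;\tau_+,\theta_\tau)$ is at least $\tau_+$, for all $\tau_+,\theta_\tau$. Draw $\tau_0,\tau_1,\dots$ i.i.d. from $D_\tau(\cdot;\tau_+,\theta_\tau)$, independently of the samples and of the solver's randomness, and let $K=\inf\{N:\sum_{k=0}^{N-1}\tau_k\ge S_\tau\}$, $\Sigma_\tau=\sum_{k=0}^{K-1}\tau_k$. **Claim.**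 There are constants $C_\Sigma,C_A,C_B,C_a,C_b,C_p,C>0$ and $p\in\mathbb N$, depending only on $l_f,l_g,L_g,\sigma_g,\sigma_{g'},\widehat l_g,\widehat L_g,M,\Gamma,C_\tau$, such that for all $m,n$ and $\Delta_0\in(0,1)$ there is $\epsilon_0>0$ (depending only on the quantities listed above and $m,n,\Delta_0$) such that for all $0<\epsilon<\epsilon_0$, $0<\Delta\le\Delta_0$, every problem, solver and family of laws as above and every $\theta_\tau$, the following holds. Set $\tau_+=\lceil\epsilon^{-1/3}\rceil$, $S_\tau=\lceil C_\Sigma\epsilon^{-1}\rceil$, $A=\lceil C_A\epsilon^{-2}\log\frac{5(m+1)S_\tau}\Delta\rceil$, $B=\lceil C_B\epsilon^{-1}\log\frac{5(m+n)S_\tau}\Delta\rceil$, $a=\lceil C_a\tau_+^2\epsilon^{-1}\log\frac{5(m+1)S_\tau}\Delta\rceil$, $b=\lceil C_b\tau_+^2\log\frac{5(m+n)S_\tau}\Delta\rceil$, $\overline\delta=\frac{\Delta}{2(S_\tau+\tau_+)}$, $\overline\epsilon=\frac{\epsilon}{5\cdot30M}$. Then with probability at least $1-\Delta-\exp(-C_p\epsilon^{-2/3})$,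 simultaneously: (i) $\displaystyle\frac1{\Sigma_\tau}\sum_{k=0}^{K-1}\sum_{i=0}^{\tau_k-1}\|\mathcal G_M(x_i^k)\|_2^2\le\epsilon$; (ii) the evaluation and Jacobian complexities are at most $C\epsilon^{-8/3}(\log\frac1\epsilon)^p\log\frac1\Delta$ and $C\epsilon^{-5/3}(\log\frac1\epsilon)^p\log\frac1\Delta$ respectively, i.e. $\widetilde\Theta(\epsilon^{-8/3}\log(1/\Delta))$ and $\widetilde\Theta(\epsilon^{-5/3}\log(1/\Delta))$. -/

import Mathlib

open MeasureTheory

namespace VRProxLinear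

noncomputable section

/-- `ℝᵈ` with the Euclidean norm.  The norm of `Vec n →L[ℝ] Vec m` is then the spectral norm. -/
abbrev Vec (d : ℕ) : Type := EuclideanSpace ℝ (Fin d)

/-- A function `h : ℝⁿ → ℝ ∪ {+∞}` that is closed (lower semicontinuous), convex (its epigraph is
convex) and proper (never `-∞`, not identically `+∞`). -/
structure ClosedConvexProper {n : ℕ} (h : Vec n → EReal) : Prop where
  ne_bot : ∀ x, h x ≠ ⊥
  exists_ne_top : ∃ x, h x ≠ ⊤
  convex_epigraph : Convex ℝ {p : Vec n × ℝ | h p.1 ≤ (p.2 : EReal)}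
  lowerSemicontinuous : LowerSemicontinuous h

/-- The standing assumptions on `f`, `g`, `h`: `f` is convex and `l_f`-Lipschitz, `g` is
differentiable and `l_g`-Lipschitz with `L_g`-Lipschitz Jacobian in operator norm, and `h` is closed,
convex and proper. -/
structure StandingAssumptions {m n : ℕ} (f : Vec m → ℝ) (g : Vec n → Vec m) (h : Vec n → EReal)
    (l_f l_g L_g : ℝ) : Prop where
  f_convex : ConvexOn ℝ Set.univ f
  f_lipschitz : ∀ u v, |f u - f v| ≤ l_f * ‖u - v‖
  g_differentiable : Differentiable ℝ g
  g_lipschitz : ∀ x y, ‖g x - g y‖ ≤ l_g * ‖x - y‖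
  g_jacobian_lipschitz : ∀ x y, ‖fderiv ℝ g x - fderiv ℝ g y‖ ≤ L_g * ‖x - y‖
  h_closed_convex_proper : ClosedConvexProper h

/-- The composite objective `Φ(x) = f(g(x)) + h(x)`. -/
def objective {m n : ℕ} (f : Vec m → ℝ) (g : Vec n → Vec m) (h : Vec n → EReal) (x : Vec n) :
    EReal :=
  (f (g x) : EReal) + h x

/-- The prox-linear subproblem objective at `x`, built from a value `v` and a Jacobian `J`:
`y ↦ f(v + J(y - x)) + h(y) + (M/2)‖y - x‖²`. -/
def subproblem {m n : ℕ} (f : Vec m → ℝ) (h : Vec n → EReal) (M : ℝ)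
    (x : Vec n) (v : Vec m) (J : Vec n →L[ℝ] Vec m) (y : Vec n) : EReal :=
  ((f (v + J (y - x)) + M / 2 * ‖y - x‖ ^ 2 : ℝ) : EReal) + h y

/-- The exact prox-linear point `x₊ = argmin_y f(g(x) + g'(x)(y - x)) + h(y) + (M/2)‖y - x‖²`
(for `M > 0` the minimizer exists and is unique, by strong convexity). -/
def proxLinearPoint {m n : ℕ} (f : Vec m → ℝ) (g : Vec n → Vec m) (h : Vec n → EReal) (M : ℝ)
    (x : Vec n) : Vec n :=
  Classical.epsilon fun y => ∀ z,
    subproblem f h M x (g x) (fderiv ℝ g x) y ≤ subproblem f h M x (g x) (fderiv ℝ g x) z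

/-- The generalized gradient `𝒢_M(x) = M (x - x₊)`. -/
def generalizedGradient {m n : ℕ} (f : Vec m → ℝ) (g : Vec n → Vec m) (h : Vec n → EReal) (M : ℝ)
    (x : Vec n) : Vec n :=
  M • (x - proxLinearPoint f g h M x)

section Oracle

variable {m n : ℕ} {Ξ : Type*} [MeasurableSpace Ξ]

/-- The inner mapping `g(x) = 𝔼_{ξ ∼ D} [g_ξ(x)]`. -/
def innerMap (D : Measure Ξ) (G : Ξ → Vec n → Vec m) (x : Vec n) : Vec m :=
  ∫ ξ, G ξ x ∂D

/-- The components `g_ξ` can be queried for values and Jacobians: both are measurable in `(ξ, x)`,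
the `g_ξ` are differentiable, and the expectation defining `g` makes sense. -/
structure OracleRegularity (D : Measure Ξ) (G : Ξ → Vec n → Vec m) : Prop where
  measurable_value : Measurable fun q : Ξ × Vec n => G q.1 q.2
  measurable_jacobian : Measurable fun q : Ξ × Vec n => fderiv ℝ (G q.1) q.2
  differentiable : ∀ᵐ ξ ∂D, Differentiable ℝ (G ξ)
  integrable : ∀ x, Integrable (fun ξ => G ξ x) D

/-- For `D`-almost every `ξ` and every `x`, the value and the Jacobian of `g_ξ` at `x` deviate from
those of `g` by at most `σ_g` and `σ_J` (in operator norm). -/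
structure BoundedDeviation (D : Measure Ξ) (G : Ξ → Vec n → Vec m) (σ_g σ_J : ℝ) : Prop where
  value : ∀ᵐ ξ ∂D, ∀ x, ‖G ξ x - innerMap D G x‖ ≤ σ_g
  jacobian : ∀ᵐ ξ ∂D, ∀ x, ‖fderiv ℝ (G ξ) x - fderiv ℝ (innerMap D G) x‖ ≤ σ_J

/-- For `D`-almost every `ξ`, `g_ξ` is `lhat`-Lipschitz and its Jacobian is `Lhat`-Lipschitz in
operator norm. -/
structure UniformLipschitz (D : Measure Ξ) (G : Ξ → Vec n → Vec m) (lhat Lhat : ℝ) : Prop where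
  value : ∀ᵐ ξ ∂D, ∀ x y, ‖G ξ x - G ξ y‖ ≤ lhat * ‖x - y‖
  jacobian : ∀ᵐ ξ ∂D, ∀ x y, ‖fderiv ℝ (G ξ) x - fderiv ℝ (G ξ) y‖ ≤ Lhat * ‖x - y‖

end Oracle

/-- A randomized solver takes an objective `s`, an accuracy, a failure probability and a random
seed, and returns a point. -/
abbrev Solver (n : ℕ) (Seed : Type*) : Type _ := (Vec n → EReal) → ℝ → ℝ → Seed → Vec n

/-- The assumption on the solver (with seed drawn from `Q`): on each prox-linear subproblem `s`, for
all `ebar, dbar > 0`, with probability at least `1 - dbar` its output `y` is `ebar`-optimal, i.e.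
`s(y) ≤ inf s + ebar`.  The output is a measurable function of the subproblem data and the seed. -/
structure SolverAssumption {m n : ℕ} {Seed : Type*} [MeasurableSpace Seed] (f : Vec m → ℝ)
    (h : Vec n → EReal) (M : ℝ) (Q : Measure Seed) (solver : Solver n Seed) : Prop where
  measurable : ∀ ebar dbar : ℝ, 0 < ebar → 0 < dbar →
    Measurable fun q : (Vec n × Vec m × (Vec n →L[ℝ] Vec m)) × Seed =>
      solver (subproblem f h M q.1.1 q.1.2.1 q.1.2.2) ebar dbar q.2
  approx_optimal : ∀ ebar dbar : ℝ, 0 < ebar → 0 < dbar →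
    ∀ (x : Vec n) (v : Vec m) (J : Vec n →L[ℝ] Vec m),
      1 - dbar ≤ Q.real {u | subproblem f h M x v J (solver (subproblem f h M x v J) ebar dbar u) ≤
        (⨅ y, subproblem f h M x v J y) + (ebar : EReal)}

/-- The assumption on the parametric family `Dτ(·; τplus, θ)` of epoch-length laws: the support of
`Dτ(·; τplus, θ)` is contained in `{1, …, τplus}`, and `C_τ` times its mean is at least `τplus`. -/
structure EpochLawAssumption {Θ : Type*} (Dτ : ℕ → Θ → PMF ℕ) (C_τ : ℝ) : Prop where
  support_subset : ∀ (τplus : ℕ) (θ : Θ), 1 ≤ τplus → (Dτ τplus θ).support ⊆ Set.Icc 1 τplus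
  mean_ge : ∀ (τplus : ℕ) (θ : Θ), 1 ≤ τplus → (τplus : ℝ) ≤ C_τ * ∫ t, (t : ℝ) ∂(Dτ τplus θ).toMeasure

/-- The batch sizes of the variance-reduced estimator: `A`, `B` at the start of an epoch (values,
Jacobians), `a`, `b` afterwards. -/
structure BatchSizes where
  A : ℕ
  B : ℕ
  a : ℕ
  b : ℕ

/-- All the random inputs of the method: the epoch lengths `τ₀, τ₁, …`, the samples
`ξ` in the batches `𝒜ᵢᵏ` and `ℬᵢᵏ` (indexed by `(k, i, r)`), and the solver seeds (indexed by
`(k, i)`). -/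
abbrev Inputs (Ξ Seed : Type*) : Type _ :=
  (ℕ → ℕ) × (ℕ × ℕ × ℕ → Ξ) × (ℕ × ℕ × ℕ → Ξ) × (ℕ × ℕ → Seed)

/-- The law of the random inputs: everything is independent, epoch lengths have law `ν`, samples
have law `D`, seeds have law `Q`. -/
def inputLaw {Ξ Seed : Type*} [MeasurableSpace Ξ] [MeasurableSpace Seed] (ν : PMF ℕ)
    (D : Measure Ξ) [IsProbabilityMeasure D] (Q : Measure Seed) [IsProbabilityMeasure Q] :
    Measure (Inputs Ξ Seed) :=
  (Measure.infinitePi fun _ : ℕ => ν.toMeasure).prod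
    ((Measure.infinitePi fun _ : ℕ × ℕ × ℕ => D).prod
      ((Measure.infinitePi fun _ : ℕ × ℕ × ℕ => D).prod
        (Measure.infinitePi fun _ : ℕ × ℕ => Q)))

section Algorithm

variable {m n : ℕ} {Ξ Seed : Type*}

/-- The value estimate `g̃ᵢᵏ` at the current point `x`, in the epoch `k` that started at `x₀`. -/
def valueEstimate (G : Ξ → Vec n → Vec m) (N : BatchSizes) (w : Inputs Ξ Seed)
    (k : ℕ) (x₀ : Vec n) (i : ℕ) (x : Vec n) : Vec m :=
  let g₀ : Vec m := (N.A : ℝ)⁻¹ • ∑ r ∈ Finset.range N.A, G (w.2.1 (k, 0, r)) x₀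
  if i = 0 then g₀
  else (N.a : ℝ)⁻¹ • ∑ r ∈ Finset.range N.a,
    (G (w.2.1 (k, i, r)) x - G (w.2.1 (k, i, r)) x₀) + g₀

/-- The Jacobian estimate `J̃ᵢᵏ` at the current point `x`, in the epoch `k` that started at `x₀`. -/
def jacobianEstimate (G : Ξ → Vec n → Vec m) (N : BatchSizes) (w : Inputs Ξ Seed)
    (k : ℕ) (x₀ : Vec n) (i : ℕ) (x : Vec n) : Vec n →L[ℝ] Vec m :=
  let J₀ : Vec n →L[ℝ] Vec m :=
    (N.B : ℝ)⁻¹ • ∑ r ∈ Finset.range N.B, fderiv ℝ (G (w.2.2.1 (k, 0, r))) x₀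
  if i = 0 then J₀
  else (N.b : ℝ)⁻¹ • ∑ r ∈ Finset.range N.b,
    (fderiv ℝ (G (w.2.2.1 (k, i, r))) x - fderiv ℝ (G (w.2.2.1 (k, i, r))) x₀) + J₀

/-- The inner loop: the `i`-th iterate of the epoch `k` that starts at `x₀`. -/
def innerIterate (f : Vec m → ℝ) (h : Vec n → EReal) (G : Ξ → Vec n → Vec m) (M : ℝ)
    (solver : Solver n Seed) (ebar dbar : ℝ) (N : BatchSizes) (w : Inputs Ξ Seed)
    (k : ℕ) (x₀ : Vec n) : ℕ → Vec n
  | 0 => x₀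
  | i + 1 =>
    let x := innerIterate f h G M solver ebar dbar N w k x₀ i
    solver (subproblem f h M x (valueEstimate G N w k x₀ i x) (jacobianEstimate G N w k x₀ i x))
      ebar dbar (w.2.2.2 (k, i))

/-- The outer loop: the starting point `x₀ᵏ` of the epoch `k`, with `x₀ᵏ⁺¹ = x_{τₖ}ᵏ`. -/
def epochStart (f : Vec m → ℝ) (h : Vec n → EReal) (G : Ξ → Vec n → Vec m) (M : ℝ)
    (solver : Solver n Seed) (ebar dbar : ℝ) (N : BatchSizes) (xinit : Vec n)
    (w : Inputs Ξ Seed) : ℕ → Vec n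
  | 0 => xinit
  | k + 1 => innerIterate f h G M solver ebar dbar N w k
      (epochStart f h G M solver ebar dbar N xinit w k) (w.1 k)

/-- The iterate `xᵢᵏ` of the method. -/
def iterate (f : Vec m → ℝ) (h : Vec n → EReal) (G : Ξ → Vec n → Vec m) (M : ℝ)
    (solver : Solver n Seed) (ebar dbar : ℝ) (N : BatchSizes) (xinit : Vec n)
    (w : Inputs Ξ Seed) (k i : ℕ) : Vec n :=
  innerIterate f h G M solver ebar dbar N w k
    (epochStart f h G M solver ebar dbar N xinit w k) i

end Algorithm

/-- The number of epochs `K = inf {N : τ₀ + ⋯ + τ_{N-1} ≥ S}`. -/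
def epochCount (S : ℕ) (τ : ℕ → ℕ) : ℕ :=
  sInf {N | S ≤ ∑ k ∈ Finset.range N, τ k}

/-- The total number of iterations `Σ_τ = τ₀ + ⋯ + τ_{K-1}`. -/
def totalIterations (S : ℕ) (τ : ℕ → ℕ) : ℕ :=
  ∑ k ∈ Finset.range (epochCount S τ), τ k

/-- The number of evaluations of components `g_ξ`: iteration `(k, 0)` uses `A` of them, and iteration
`(k, i)` with `i > 0` uses `2a` (each sample is evaluated at `xᵢᵏ` and at `x₀ᵏ`). -/
def valueCalls (N : BatchSizes) (S : ℕ) (τ : ℕ → ℕ) : ℕ :=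
  ∑ k ∈ Finset.range (epochCount S τ), ∑ i ∈ Finset.range (τ k), if i = 0 then N.A else 2 * N.a

/-- The number of evaluations of Jacobians `g_ξ'`: iteration `(k, 0)` uses `B` of them, and iteration
`(k, i)` with `i > 0` uses `2b`. -/
def jacobianCalls (N : BatchSizes) (S : ℕ) (τ : ℕ → ℕ) : ℕ :=
  ∑ k ∈ Finset.range (epochCount S τ), ∑ i ∈ Finset.range (τ k), if i = 0 then N.B else 2 * N.b

/-- The average of `‖𝒢_M(xᵢᵏ)‖²` over all the iterations of the method. -/
def averageSqGradient {m n : ℕ} {Ξ Seed : Type*} [MeasurableSpace Ξ] (D : Measure Ξ)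
    (f : Vec m → ℝ) (h : Vec n → EReal) (G : Ξ → Vec n → Vec m) (M : ℝ)
    (solver : Solver n Seed) (ebar dbar : ℝ) (N : BatchSizes) (xinit : Vec n) (S : ℕ)
    (w : Inputs Ξ Seed) : ℝ :=
  (1 / (totalIterations S w.1 : ℝ)) *
    ∑ k ∈ Finset.range (epochCount S w.1), ∑ i ∈ Finset.range (w.1 k),
      ‖generalizedGradient f (innerMap D G) h M
        (iterate f h G M solver ebar dbar N xinit w k i)‖ ^ 2

end

end VRProxLinear

open VRProxLinear

/-! Deterministic part. Strong convexity of the model and `5 l_f L_g < M` give, for an `e`-minimizer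
`y` of the model built from estimates `v`, `J` (`descent_step`), `Φ(y) + M/5 ‖y - x‖² + M/10 ‖x -
x₊‖² ≤ Φ(x) + O(e) + O(‖v - g(x)‖) + O(‖J - g'(x)‖²)`. The value error enters linearly and the
Jacobian error quadratically, which fixes the accuracies: on a good run the value error is at most
`κε + κ√ε/τ₊ · d` and the Jacobian error at most `λ√ε + λ/τ₊ · d`, where `d = ‖x - x₀‖` is the
distance to the start of the epoch. Both contributions are then at most `β(ε + d²/τ₊²)` in total
(`estimate_errors_le`). Since an epoch has at most `τ₊` steps, Cauchy–Schwarz bounds the sum of the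
`d²/τ₊²` by the sum of the squared step lengths, and `β ≤ M/5` lets the term `M/5 ‖y - x‖²` absorb
it (`epoch_descent`). Telescoping over all epochs and dividing by `Σ ≥ S` bounds the average of
`‖𝒢_M‖² = M²‖x - x₊‖²` (`averageSqGradient_le`).

Probabilistic part. The batch and the seed used at iteration `(k, i)` are independent of the points
they are applied to; `measure_fresh_le` expresses this by resampling these coordinates. For frozen
points, Hoeffding's inequality along finitely many dual vectors that norm the space controls a batch
average (`measure_average_sub_gt_le`). The number of these vectors depends on `m`, `n` only, so it
affects `ε₀` and not the constants. Given the epoch lengths, a union bound over at most `S + τ₊`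
iterations costs `Δ` in all.

Cost. Hoeffding for the epoch lengths shows that `T ~ ε^(-2/3)` epochs contain `S` iterations,
except with probability `exp(-C_p ε^(-2/3))`. With `z = ε^(-1/3)` and up to logarithms, `A ~ z⁶`, `a
~ z⁵`, `B ~ z³`, `b ~ z²`, and there are `O(z²)` epochs and `O(z³)` iterations: epoch starts and
inner iterations both cost `z⁸` values and `z⁵` Jacobians, which is the balance struck by `τ₊ ~ z`.
-/

namespace VRProxLinear

/-! ### The prox-linear subproblem -/

section ProxLinear

variable {m n : ℕ} {f : Vec m → ℝ} {g : Vec n → Vec m} {h : Vec n → EReal} {M : ℝ}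

/-- The finite part of the prox-linear subproblem objective. -/
noncomputable def smoothPart (f : Vec m → ℝ) (M : ℝ) (x : Vec n) (v : Vec m)
    (J : Vec n →L[ℝ] Vec m) (y : Vec n) : ℝ :=
  f (v + J (y - x)) + M / 2 * ‖y - x‖ ^ 2

theorem subproblem_eq (x : Vec n) (v : Vec m) (J : Vec n →L[ℝ] Vec m) (y : Vec n) :
    subproblem f h M x v J y = (smoothPart f M x v J y : EReal) + h y := rfl

theorem subproblem_of_eq_coe (x : Vec n) (v : Vec m) (J : Vec n →L[ℝ] Vec m) {y : Vec n} {b : ℝ}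
    (hy : h y = b) : subproblem f h M x v J y = ((smoothPart f M x v J y + b : ℝ) : EReal) := by
  rw [subproblem_eq, hy, EReal.coe_add]

theorem ClosedConvexProper.eq_coe (hh : ClosedConvexProper h) {x : Vec n} (hx : h x ≠ ⊤) :
    ∃ a : ℝ, h x = a :=
  ⟨(h x).toReal, (EReal.coe_toReal hx (hh.ne_bot x)).symm⟩

theorem ClosedConvexProper.midpoint_le (hh : ClosedConvexProper h) {y z : Vec n} {a b : ℝ}
    (hy : h y = a) (hz : h z = b) :
    ∃ c : ℝ, h ((1 / 2 : ℝ) • y + (1 / 2 : ℝ) • z) = c ∧ c ≤ (a + b) / 2 := by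
  have key := hh.convex_epigraph (x := (y, a)) (by simp [hy]) (y := (z, b)) (by simp [hz])
    (a := 1 / 2) (b := 1 / 2) (by norm_num) (by norm_num) (by norm_num)
  simp only [Set.mem_ofPred_eq, Prod.smul_mk, Prod.mk_add_mk, smul_eq_mul] at key
  obtain ⟨c, hc⟩ := hh.eq_coe (x := (1 / 2 : ℝ) • y + (1 / 2 : ℝ) • z)
    (ne_top_of_le_ne_top (EReal.coe_ne_top _) key)
  refine ⟨c, hc, ?_⟩
  rw [hc, EReal.coe_le_coe_iff] at key
  linarith

/-- Convexity of `f` handles the composite term, and the parallelogram law makes the midpoint gain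
of the quadratic term exactly `M/8 ‖z - y‖²`. -/
theorem smoothPart_midpoint_le (hf : ConvexOn ℝ Set.univ f) (x : Vec n) (v : Vec m)
    (J : Vec n →L[ℝ] Vec m) (y z : Vec n) :
    smoothPart f M x v J ((1 / 2 : ℝ) • y + (1 / 2 : ℝ) • z) + M / 8 * ‖z - y‖ ^ 2 ≤
      (smoothPart f M x v J y + smoothPart f M x v J z) / 2 := by
  unfold smoothPart
  have hconv := hf.2
  have h1 := hconv (Set.mem_univ (v + J (y - x))) (Set.mem_univ (v + J (z - x)))
    (a := 1 / 2) (b := 1 / 2) (by norm_num) (by norm_num) (by norm_num)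
  have h2 : (1 / 2 : ℝ) • (v + J (y - x)) + (1 / 2 : ℝ) • (v + J (z - x)) =
      v + J ((1 / 2 : ℝ) • y + (1 / 2 : ℝ) • z - x) := by
    simp only [map_sub, map_add, map_smul]
    module
  rw [h2] at h1
  have h3 := parallelogram_law_with_norm ℝ (y - x) (z - x)
  have h4 : (1 / 2 : ℝ) • y + (1 / 2 : ℝ) • z - x = (1 / 2 : ℝ) • ((y - x) + (z - x)) := by module
  have h5 : ‖(1 / 2 : ℝ) • y + (1 / 2 : ℝ) • z - x‖ = 1 / 2 * ‖(y - x) + (z - x)‖ := by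
    rw [h4, norm_smul]; norm_num
  have h6 : y - x - (z - x) = -(z - y) := by abel
  rw [h6, norm_neg] at h3
  rw [h5]
  simp only [smul_eq_mul] at h1
  linear_combination h1 + M / 8 * h3

/-- Strong convexity: an `e`-minimizer of the subproblem beats every point by a quadratic margin. -/
theorem quadratic_margin (hf : ConvexOn ℝ Set.univ f) (hh : ClosedConvexProper h)
    (x : Vec n) (v : Vec m) (J : Vec n →L[ℝ] Vec m) {y z : Vec n} {a b e : ℝ}
    (hy : h y = a) (hz : h z = b)
    (hmin : ∀ z, subproblem f h M x v J y ≤ subproblem f h M x v J z + (e : EReal)) :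
    smoothPart f M x v J y + a + M / 4 * ‖z - y‖ ^ 2 ≤ smoothPart f M x v J z + b + 2 * e := by
  obtain ⟨c, hc, hcle⟩ := hh.midpoint_le hy hz
  -- Near-optimality against the midpoint, doubled, turns `M/8` into `M/4` and `e` into `2e`. For an
  -- exact minimizer the sharp modulus would be `M/2`, but `M/4` suffices below.
  have h1 := hmin ((1 / 2 : ℝ) • y + (1 / 2 : ℝ) • z)
  rw [subproblem_of_eq_coe _ _ _ hy, subproblem_of_eq_coe _ _ _ hc, ← EReal.coe_add,
    EReal.coe_le_coe_iff] at h1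
  have h2 := smoothPart_midpoint_le (M := M) hf x v J y z
  linarith

/-- Mean value inequality on the segment. It gives `L_g` instead of the sharp `L_g/2`; the slack in
`5 l_f L_g < M` pays for this. -/
theorem norm_linearization_le {l_f l_g L_g : ℝ} (hs : StandingAssumptions f g h l_f l_g L_g)
    (hL : 0 ≤ L_g) (x y : Vec n) :
    ‖g y - (g x + fderiv ℝ g x (y - x))‖ ≤ L_g * ‖y - x‖ ^ 2 := by
  have key := (convex_segment (𝕜 := ℝ) x y).norm_image_sub_le_of_norm_hasFDerivWithin_le'
    (f := g) (f' := fderiv ℝ g) (φ := fderiv ℝ g x) (C := L_g * ‖y - x‖)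
    (fun z _ => (hs.g_differentiable z).hasFDerivAt.hasFDerivWithinAt)
    (fun z hz => (hs.g_jacobian_lipschitz z x).trans
      (mul_le_mul_of_nonneg_left (by
        obtain ⟨t, ⟨ht0, ht1⟩, rfl⟩ := (segment_eq_image' ℝ x y ▸ hz)
        rw [add_sub_cancel_left, norm_smul, Real.norm_of_nonneg ht0]
        exact mul_le_of_le_one_left (norm_nonneg _) ht1) hL))
    (left_mem_segment ℝ x y) (right_mem_segment ℝ x y)
  rw [sub_sub] at key
  nlinarith [key]

theorem abs_sub_linearization_le {l_f l_g L_g : ℝ} (hs : StandingAssumptions f g h l_f l_g L_g)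
    (hl : 0 ≤ l_f) (hL : 0 ≤ L_g) (x y : Vec n) :
    |f (g y) - f (g x + fderiv ℝ g x (y - x))| ≤ l_f * L_g * ‖y - x‖ ^ 2 := by
  refine (hs.f_lipschitz _ _).trans ?_
  rw [mul_assoc]
  exact mul_le_mul_of_nonneg_left (norm_linearization_le hs hL x y) hl

theorem continuous_of_abs_sub_le {l_f : ℝ} (hf : ∀ u v, |f u - f v| ≤ l_f * ‖u - v‖) :
    Continuous f := by
  refine (LipschitzWith.of_dist_le_mul (K := Real.toNNReal l_f) fun u v => ?_).continuous
  rw [Real.dist_eq, dist_eq_norm]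
  exact (hf u v).trans (mul_le_mul_of_nonneg_right (Real.le_coe_toNNReal _) (norm_nonneg _))

theorem subproblem_lowerSemicontinuous {l_f : ℝ} (hf : ∀ u v, |f u - f v| ≤ l_f * ‖u - v‖)
    (hh : ClosedConvexProper h) (x : Vec n) (v : Vec m) (J : Vec n →L[ℝ] Vec m) :
    LowerSemicontinuous (subproblem f h M x v J) := by
  have hfc : Continuous f := continuous_of_abs_sub_le hf
  have hc : Continuous fun y => (smoothPart f M x v J y : EReal) := by
    unfold smoothPart
    exact continuous_coe_real_ereal.comp (by fun_prop)
  refine hc.lowerSemicontinuous.add' hh.lowerSemicontinuous fun y => ?_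
  exact EReal.continuousAt_add (Or.inl (EReal.coe_ne_top _)) (Or.inl (EReal.coe_ne_bot _))

/-- The exact prox-linear point exists when the composite objective is bounded below. -/
theorem proxLinearPoint_spec {l_f l_g L_g Φ₀ : ℝ} (hs : StandingAssumptions f g h l_f l_g L_g)
    (hl : 0 ≤ l_f) (hL : 0 ≤ L_g) (hM : 5 * l_f * L_g < M)
    (hΦ : ∀ x, (Φ₀ : EReal) ≤ objective f g h x) (x : Vec n) (z : Vec n) :
    subproblem f h M x (g x) (fderiv ℝ g x) (proxLinearPoint f g h M x) ≤
      subproblem f h M x (g x) (fderiv ℝ g x) z := by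
  revert z
  have hlL : 0 ≤ l_f * L_g := mul_nonneg hl hL
  have hh := hs.h_closed_convex_proper
  have hMpos : 0 < M := by linarith
  refine Classical.epsilon_spec
    (p := fun y => ∀ z, subproblem f h M x (g x) (fderiv ℝ g x) y ≤
      subproblem f h M x (g x) (fderiv ℝ g x) z) ?_
  obtain ⟨y₀, hy₀⟩ := hh.exists_ne_top
  obtain ⟨a₀, ha₀⟩ := hh.eq_coe hy₀
  set s := subproblem f h M x (g x) (fderiv ℝ g x) with hsdef
  set c : ℝ := smoothPart f M x (g x) (fderiv ℝ g x) y₀ + a₀ with hc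
  have hs₀ : s y₀ = (c : EReal) := subproblem_of_eq_coe _ _ _ ha₀
  -- Coercivity: the model is at least `Φ(y) + (M/2 - l_f L_g)‖y - x‖²` and `l_f L_g ≤ M/5 < M/4`.
  -- Hence sublevel sets are bounded, and a minimizer over a closed ball is a global one.
  have hcoer : ∀ y, s y ≤ (c : EReal) → M / 4 * ‖y - x‖ ^ 2 ≤ c - Φ₀ := by
    intro y hy
    have hyt : h y ≠ ⊤ := by
      intro htop
      rw [hsdef, subproblem_eq, htop, EReal.coe_add_top] at hy
      exact absurd hy (not_le.2 (EReal.coe_lt_top _))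
    obtain ⟨b, hb⟩ := hh.eq_coe hyt
    have h1 := hΦ y
    rw [objective, hb, ← EReal.coe_add, EReal.coe_le_coe_iff] at h1
    rw [hsdef, subproblem_of_eq_coe _ _ _ hb, EReal.coe_le_coe_iff, smoothPart] at hy
    have h2 := (abs_le.1 (abs_sub_linearization_le hs hl hL x y)).2
    nlinarith [sq_nonneg ‖y - x‖]
  obtain ⟨r, hr⟩ : ∃ r : ℝ, ∀ y, s y ≤ (c : EReal) → ‖y - x‖ ≤ r := by
    refine ⟨Real.sqrt ((c - Φ₀) / (M / 4)), fun y hy => Real.le_sqrt_of_sq_le ?_⟩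
    rw [le_div_iff₀ (by positivity), mul_comm]
    exact hcoer y hy
  obtain ⟨p, -, hpmin⟩ := LowerSemicontinuousOn.exists_isMinOn
    (s := Metric.closedBall x r) (f := s)
    ⟨y₀, by simpa [dist_eq_norm] using hr y₀ hs₀.le⟩ (isCompact_closedBall x r)
    ((subproblem_lowerSemicontinuous hs.f_lipschitz hh x _ _).lowerSemicontinuousOn _)
  refine ⟨p, fun z => ?_⟩
  by_cases hz : s z ≤ (c : EReal)
  · exact hpmin (by simpa [dist_eq_norm] using hr z hz)
  · refine le_trans ?_ (not_le.1 hz).le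
    rw [← hs₀]
    exact hpmin (by simpa [dist_eq_norm] using hr y₀ hs₀.le)

theorem abs_smoothPart_sub_le {l_f l_g L_g : ℝ} (hs : StandingAssumptions f g h l_f l_g L_g)
    (hl : 0 ≤ l_f) (x : Vec n) (v : Vec m) (J : Vec n →L[ℝ] Vec m) (y : Vec n) :
    |smoothPart f M x v J y - smoothPart f M x (g x) (fderiv ℝ g x) y| ≤
      l_f * (‖v - g x‖ + ‖J - fderiv ℝ g x‖ * ‖y - x‖) := by
  unfold smoothPart
  rw [add_sub_add_right_eq_sub]
  refine (hs.f_lipschitz _ _).trans (mul_le_mul_of_nonneg_left ?_ hl)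
  have : v + J (y - x) - (g x + fderiv ℝ g x (y - x)) =
      (v - g x) + (J - fderiv ℝ g x) (y - x) := by
    simp only [sub_apply]; abel
  rw [this]
  exact (norm_add_le _ _).trans (add_le_add_right (ContinuousLinearMap.le_opNorm _ _) _)

/-- Young's inequality, weighted so that each cross term costs only `M/20` of a quadratic term. -/
theorem mul_le_sq_add_sq {M : ℝ} (hM : 0 < M) (a b : ℝ) :
    a * b ≤ M / 20 * b ^ 2 + 5 / M * a ^ 2 := by
  have key : 0 ≤ (M * b - 10 * a) ^ 2 / (20 * M) := by positivity
  have : (M * b - 10 * a) ^ 2 / (20 * M) = M / 20 * b ^ 2 + 5 / M * a ^ 2 - a * b := by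
    field_simp; ring
  linarith

/-- One inexact prox-linear step decreases the objective, up to the errors of the estimates. -/
theorem descent_step {l_f l_g L_g Φ₀ : ℝ} (hs : StandingAssumptions f g h l_f l_g L_g)
    (hl : 0 ≤ l_f) (hL : 0 ≤ L_g) (hM : 5 * l_f * L_g < M)
    (hΦ : ∀ x, (Φ₀ : EReal) ≤ objective f g h x) {e a : ℝ} {x y : Vec n} (v : Vec m)
    (J : Vec n →L[ℝ] Vec m) (hx : h x = a)
    (hy : subproblem f h M x v J y ≤ (⨅ z, subproblem f h M x v J z) + (e : EReal)) :
    ∃ b : ℝ, h y = b ∧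
      f (g y) + b + M / 5 * ‖y - x‖ ^ 2 + M / 10 * ‖x - proxLinearPoint f g h M x‖ ^ 2 ≤
        f (g x) + a + 16 / 5 * e + 5 * l_f * ‖v - g x‖ +
          100 * l_f ^ 2 / M * ‖J - fderiv ℝ g x‖ ^ 2 := by
  have hlL : 0 ≤ l_f * L_g := mul_nonneg hl hL
  have hh := hs.h_closed_convex_proper
  have hMpos : 0 < M := by linarith
  set p := proxLinearPoint f g h M x with hp
  have hmin : ∀ z, subproblem f h M x v J y ≤ subproblem f h M x v J z + (e : EReal) :=
    fun z => hy.trans (add_le_add_left (iInf_le _ z) _)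
  have finite_of_le : ∀ {v' J' w} {t : ℝ}, subproblem f h M x v' J' w ≤ (t : EReal) →
      ∃ b : ℝ, h w = b := by
    intro v' J' w t ht
    refine hh.eq_coe fun htop => ?_
    rw [subproblem_eq, htop, EReal.coe_add_top] at ht
    exact absurd ht (not_le.2 (EReal.coe_lt_top _))
  obtain ⟨b, hb⟩ : ∃ b : ℝ, h y = b := by
    have h1 := hmin x
    rw [subproblem_of_eq_coe _ _ _ hx, ← EReal.coe_add] at h1
    exact finite_of_le h1
  have hpmin := proxLinearPoint_spec hs hl hL hM hΦ x
  obtain ⟨c, hc⟩ : ∃ c : ℝ, h p = c := by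
    have h1 := hpmin x
    rw [subproblem_of_eq_coe _ _ _ hx] at h1
    exact finite_of_le h1
  refine ⟨b, hb, ?_⟩
  have hmarg := quadratic_margin (M := M) hs.f_convex hh x v J hb hx hmin
  have hmarg' := quadratic_margin (M := M) (e := 0) hs.f_convex hh x (g x) (fderiv ℝ g x) hc hb
    (by simpa using hpmin)
  have hyp := hmin p
  rw [subproblem_of_eq_coe _ _ _ hb, subproblem_of_eq_coe _ _ _ hc, ← EReal.coe_add,
    EReal.coe_le_coe_iff] at hyp
  have d1 := abs_le.1 (abs_smoothPart_sub_le (M := M) hs hl x v J y)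
  have d2 := abs_le.1 (abs_smoothPart_sub_le (M := M) hs hl x v J p)
  have d3 := abs_le.1 (abs_smoothPart_sub_le (M := M) hs hl x v J x)
  have d4 := (abs_le.1 (abs_sub_linearization_le hs hl hL x y)).2
  have d5 : smoothPart f M x (g x) (fderiv ℝ g x) y =
    f (g x + fderiv ℝ g x (y - x)) + M / 2 * ‖y - x‖ ^ 2 := rfl
  have d6 : smoothPart f M x (g x) (fderiv ℝ g x) x = f (g x) := by simp [smoothPart]
  rw [sub_self, norm_zero, mul_zero, add_zero] at d3
  set ev := ‖v - g x‖
  set eJ := ‖J - fderiv ℝ g x‖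
  rw [norm_sub_rev x y] at hmarg
  rw [norm_sub_rev p x] at d2
  set X := ‖y - x‖
  set Y := ‖x - p‖
  set Z := ‖y - p‖
  have tri : Y ^ 2 ≤ 2 * X ^ 2 + 2 * Z ^ 2 := by
    have h0 : Y ≤ X + Z := by
      have : x - p = -(y - x) + (y - p) := by abel
      calc Y = ‖-(y - x) + (y - p)‖ := by rw [← this]
        _ ≤ _ := (norm_add_le _ _).trans_eq (by rw [norm_neg])
    nlinarith [norm_nonneg (x - p), norm_nonneg (y - x), norm_nonneg (y - p), sq_nonneg (X - Z)]
  -- The conclusion is `hmarg` plus `6/5` times `hmarg' + hyp`. This yields `16/5 = 2 + 6/5` in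
  -- front of `e`, `22/5 ≤ 5` in front of `l_f ev`, and the cross terms `l_f eJ (11/5 X + 6/5 Y)`.
  -- The quadratic gain is `(3/4 - 1/5) M X² + 3/10 M Z²`; trading `3/10 M (X² + Z²)` for `3/20 M
  -- Y²` by `tri` leaves `M/4 X² + 3/20 M Y²`, and the two Young inequalities take `M/20` from each.
  have q1 := mul_le_sq_add_sq hMpos (11 / 5 * l_f * eJ) X
  have q2 := mul_le_sq_add_sq hMpos (6 / 5 * l_f * eJ) Y
  have q3 : 5 / M * (11 / 5 * l_f * eJ) ^ 2 + 5 / M * (6 / 5 * l_f * eJ) ^ 2 ≤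
      100 * l_f ^ 2 / M * eJ ^ 2 := by
    have : 100 * l_f ^ 2 / M * eJ ^ 2 - (5 / M * (11 / 5 * l_f * eJ) ^ 2 +
      5 / M * (6 / 5 * l_f * eJ) ^ 2) = (100 - 157 / 5) * l_f ^ 2 * eJ ^ 2 / M := by
      field_simp; ring
    have : 0 ≤ (100 - 157 / 5) * l_f ^ 2 * eJ ^ 2 / M := by positivity
    linarith
  have hX2 : l_f * L_g * X ^ 2 ≤ M / 5 * X ^ 2 :=
    mul_le_mul_of_nonneg_right (by linarith) (sq_nonneg _)
  have tri' : M * Y ^ 2 ≤ M * (2 * X ^ 2 + 2 * Z ^ 2) := mul_le_mul_of_nonneg_left tri hMpos.le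
  have hev : 0 ≤ l_f * ev := mul_nonneg hl (norm_nonneg _)
  nlinarith [hmarg, hmarg', hyp, d1.1, d1.2, d2.1, d2.2, d3.1, d3.2, d4]

end ProxLinear


/-! ### Concentration of averages in finite-dimensional spaces -/

section Concentration

open ProbabilityTheory

/-- The unit ball of the dual of a finite-dimensional space contains a finite set that norms the
space up to a factor `2`. -/
theorem exists_norming_finset (E : Type*) [NormedAddCommGroup E] [NormedSpace ℝ E]
    [FiniteDimensional ℝ E] :
    ∃ U : Finset (E →L[ℝ] ℝ), (∀ u ∈ U, ‖u‖ ≤ 1) ∧ ∀ z : E, ∃ u ∈ U, ‖z‖ ≤ 2 * u z := by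
  -- A finite `1/2`-net of the dual unit ball: replacing a Hahn–Banach functional of `z` by a net
  -- point loses at most `‖z‖/2`.
  obtain ⟨t, hts, htf, htc⟩ := (isCompact_closedBall (0 : E →L[ℝ] ℝ) 1).finite_cover_balls
    (e := 1 / 2) (by norm_num)
  refine ⟨htf.toFinset, fun u hu => by simpa using hts (htf.mem_toFinset.1 hu), fun z => ?_⟩
  obtain ⟨u, hu1, huz⟩ := exists_dual_vector'' ℝ z
  obtain ⟨u', hu', hd⟩ := Set.mem_iUnion₂.1 (htc (show u ∈ Metric.closedBall 0 1 by simpa using hu1))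
  refine ⟨u', htf.mem_toFinset.2 hu', ?_⟩
  rw [Metric.mem_ball, dist_eq_norm] at hd
  have h1 : ‖(u - u') z‖ ≤ 1 / 2 * ‖z‖ :=
    ((u - u').le_opNorm z).trans (mul_le_mul_of_nonneg_right hd.le (norm_nonneg _))
  have h2 := (abs_le.1 h1).2
  rw [sub_apply, huz] at h2
  simp only [RCLike.ofReal_real_eq_id, id_eq] at h2
  linarith

variable {Ξ ι E : Type*} [MeasurableSpace Ξ] [NormedAddCommGroup E] [NormedSpace ℝ E]
  [CompleteSpace E] [MeasurableSpace E] [BorelSpace E]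

/-- Hoeffding: `u (Y - c)` is centred with values in `[-R, R]`, hence sub-Gaussian with parameter
`R²`, and `(N t/2)² / (2 N R²) = N t² / (8 R²)`. The injection `j` selects the coordinates of one
batch. -/
theorem measure_sum_dual_ge_le (D : Measure Ξ) [IsProbabilityMeasure D] (u : E →L[ℝ] ℝ)
    (hu : ‖u‖ ≤ 1) {Y : Ξ → E} (hY : Measurable Y) (hint : Integrable Y D) {c : E}
    (hc : ∫ ξ, Y ξ ∂D = c) {R : ℝ} (hR : 0 < R) (hb : ∀ᵐ ξ ∂D, ‖Y ξ - c‖ ≤ R)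
    (N : ℕ) {j : ℕ → ι} (hj : Function.Injective j) {t : ℝ} (ht : 0 ≤ t) :
    (Measure.infinitePi fun _ : ι => D).real
      {w | N * t / 2 ≤ ∑ r ∈ Finset.range N, u (Y (w (j r)) - c)} ≤
      Real.exp (-(N * t ^ 2 / (8 * R ^ 2))) := by
  rcases Nat.eq_zero_or_pos N with rfl | hN
  · simp
  set Z : Ξ → ℝ := fun ξ => u (Y ξ - c) with hZ
  have hZm : Measurable Z := u.continuous.measurable.comp (hY.sub_const c)
  have hZb : ∀ᵐ ξ ∂D, Z ξ ∈ Set.Icc (-R) R := by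
    filter_upwards [hb] with ξ hξ
    have : |Z ξ| ≤ R := by
      refine (u.le_opNorm _).trans ?_
      calc ‖u‖ * ‖Y ξ - c‖ ≤ 1 * R := mul_le_mul hu hξ (norm_nonneg _) zero_le_one
        _ = R := one_mul R
    exact abs_le.1 this
  have hZ0 : ∫ ξ, Z ξ ∂D = 0 := by
    have h1 : ∫ ξ, u (Y ξ - c) ∂D = u (∫ ξ, (Y ξ - c) ∂D) :=
      ContinuousLinearMap.integral_comp_comm u (hint.sub (integrable_const c))
    rw [hZ, h1, integral_sub hint (integrable_const c), hc]
    simp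
  have hsub := hasSubgaussianMGF_of_mem_Icc_of_integral_eq_zero hZm.aemeasurable hZb hZ0
  have hind : iIndepFun (fun (i : ι) (w : ι → Ξ) => Z (w i)) (Measure.infinitePi fun _ : ι => D) :=
    iIndepFun_infinitePi (P := fun _ : ι => D) (X := fun _ => Z) fun _ => hZm
  have hind' := iIndepFun.precomp hj hind
  have hsub' : ∀ i < N, HasSubgaussianMGF (fun w : ι → Ξ => Z (w (j i)))
      ((‖R - -R‖₊ / 2) ^ 2) (Measure.infinitePi fun _ : ι => D) := by
    intro i _
    refine HasSubgaussianMGF.of_map (X := Z) (Y := fun w : ι → Ξ => w (j i))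
      (measurable_pi_apply _).aemeasurable ?_
    have := (measurePreserving_eval_infinitePi (fun _ : ι => D) (j i)).map_eq
    rwa [← this] at hsub
  have key := HasSubgaussianMGF.measure_sum_range_ge_le_of_iIndepFun hind' hsub'
    (ε := N * t / 2) (by positivity)
  refine key.trans (Real.exp_le_exp.2 (le_of_eq ?_))
  have hNR : (0 : ℝ) < N := by exact_mod_cast hN
  have h2 : (((‖R - -R‖₊ / 2) ^ 2 : NNReal) : ℝ) = R ^ 2 := by
    push_cast
    rw [Real.norm_of_nonneg (by linarith)]
    ring
  rw [h2]
  field_simp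
  ring

/-- The average of `N` independent copies of a bounded random vector is concentrated around its
mean. -/
theorem measure_average_sub_gt_le (D : Measure Ξ) [IsProbabilityMeasure D]
    {U : Finset (E →L[ℝ] ℝ)} (hU : ∀ u ∈ U, ‖u‖ ≤ 1) (hU' : ∀ z : E, ∃ u ∈ U, ‖z‖ ≤ 2 * u z)
    {Y : Ξ → E} (hY : Measurable Y) (hint : Integrable Y D) {c : E}
    (hc : ∫ ξ, Y ξ ∂D = c) {R : ℝ} (hR : 0 < R) (hb : ∀ᵐ ξ ∂D, ‖Y ξ - c‖ ≤ R)
    (N : ℕ) {j : ℕ → ι} (hj : Function.Injective j) {t : ℝ} (ht : 0 ≤ t) :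
    (Measure.infinitePi fun _ : ι => D).real
      {w | t < ‖(N : ℝ)⁻¹ • ∑ r ∈ Finset.range N, Y (w (j r)) - c‖} ≤
      U.card * Real.exp (-(N * t ^ 2 / (8 * R ^ 2))) := by
  rcases Nat.eq_zero_or_pos N with rfl | hN
  -- For an empty batch the claimed bound is `U.card ≥ 1`.
  · obtain ⟨u, hu, -⟩ := hU' 0
    have : (1 : ℝ) ≤ U.card := by exact_mod_cast Finset.card_pos.2 ⟨u, hu⟩
    simpa using measureReal_le_one.trans this
  have hNR : (0 : ℝ) < N := by exact_mod_cast hN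
  have hsub : {w : ι → Ξ | t < ‖(N : ℝ)⁻¹ • ∑ r ∈ Finset.range N, Y (w (j r)) - c‖} ⊆
      ⋃ u ∈ U, {w | N * t / 2 ≤ ∑ r ∈ Finset.range N, u (Y (w (j r)) - c)} := by
    intro w hw
    obtain ⟨u, hu, hle⟩ := hU' ((N : ℝ)⁻¹ • ∑ r ∈ Finset.range N, Y (w (j r)) - c)
    refine Set.mem_iUnion₂.2 ⟨u, hu, ?_⟩
    have hw' : t < 2 * u ((N : ℝ)⁻¹ • ∑ r ∈ Finset.range N, Y (w (j r)) - c) :=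
      lt_of_lt_of_le hw hle
    have heq : (N : ℝ) * u ((N : ℝ)⁻¹ • ∑ r ∈ Finset.range N, Y (w (j r)) - c) =
        ∑ r ∈ Finset.range N, u (Y (w (j r)) - c) := by
      simp only [map_sub, map_smul, map_sum, Finset.sum_sub_distrib, smul_eq_mul,
        Finset.sum_const, Finset.card_range, nsmul_eq_mul]
      field_simp
    change N * t / 2 ≤ ∑ r ∈ Finset.range N, u (Y (w (j r)) - c)
    rw [← heq]
    nlinarith
  refine (measureReal_mono hsub (measure_ne_top _ _)).trans ((measureReal_biUnion_finset_le _ _).trans ?_)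
  refine (Finset.sum_le_card_nsmul _ _ _ fun u hu =>
    measure_sum_dual_ge_le D u (hU u hu) hY hint hc hR hb N hj ht).trans_eq ?_
  rw [nsmul_eq_mul]

end Concentration

/-! ### Independence of fresh coordinates -/

section Fresh

variable {ι Ξ Y : Type*} [MeasurableSpace Ξ] [MeasurableSpace Y]

open Classical in
/-- Replacing the coordinates in `s` by those of an independent copy preserves a product law. -/
theorem measurePreserving_piecewise (D : Measure Ξ) [IsProbabilityMeasure D] (s : Set ι) :
    MeasurePreserving (fun q : (ι → Ξ) × (ι → Ξ) => s.piecewise q.2 q.1)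
      ((Measure.infinitePi fun _ : ι => D).prod (Measure.infinitePi fun _ : ι => D))
      (Measure.infinitePi fun _ : ι => D) := by
  have hm : Measurable fun q : (ι → Ξ) × (ι → Ξ) => s.piecewise q.2 q.1 := by
    refine measurable_pi_lambda _ fun i => ?_
    by_cases hi : i ∈ s
    · simp only [Set.piecewise_eq_of_mem _ _ _ hi]; fun_prop
    · simp only [Set.piecewise_eq_of_notMem _ _ _ hi]; fun_prop
  refine ⟨hm, Measure.eq_infinitePi _ fun S t ht => ?_⟩
  rw [Measure.map_apply hm (MeasurableSet.pi S.countable_toSet fun i _ => ht i)]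
  have : (fun q : (ι → Ξ) × (ι → Ξ) => s.piecewise q.2 q.1) ⁻¹' (S : Set ι).pi t =
      (((S.filter (· ∉ s) : Finset ι) : Set ι).pi t) ×ˢ
        (((S.filter (· ∈ s) : Finset ι) : Set ι).pi t) := by
    ext ⟨w, w'⟩
    simp only [Set.mem_preimage, Set.mem_pi, Finset.mem_coe, Set.mem_prod, Finset.mem_filter]
    constructor
    · refine fun h => ⟨fun i hi => ?_, fun i hi => ?_⟩
      · simpa [Set.piecewise_eq_of_notMem _ _ _ hi.2] using h i hi.1
      · simpa [Set.piecewise_eq_of_mem _ _ _ hi.2] using h i hi.1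
    · rintro ⟨h1, h2⟩ i hi
      by_cases his : i ∈ s
      · simpa [Set.piecewise_eq_of_mem _ _ _ his] using h2 i ⟨hi, his⟩
      · simpa [Set.piecewise_eq_of_notMem _ _ _ his] using h1 i ⟨hi, his⟩
  rw [this, Measure.prod_prod, Measure.infinitePi_pi _ fun i _ => ht i,
    Measure.infinitePi_pi _ fun i _ => ht i, mul_comm,
    Finset.prod_filter_mul_prod_filter_not]

theorem prod_le_of_forall_section_le {X X' : Type*} [MeasurableSpace X] [MeasurableSpace X']
    (μ : Measure X) [IsProbabilityMeasure μ] (ν : Measure X') [SFinite ν] {T : Set (X × X')}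
    (hT : MeasurableSet T) {p : ENNReal} (h : ∀ x, ν {y | (x, y) ∈ T} ≤ p) :
    (μ.prod ν) T ≤ p := by
  rw [Measure.prod_apply hT]
  exact (lintegral_mono fun x => h x).trans (by simp)

theorem prod_le_of_forall_section_le' {X X' : Type*} [MeasurableSpace X] [MeasurableSpace X']
    (μ : Measure X) [SFinite μ] (ν : Measure X') [IsProbabilityMeasure ν] {T : Set (X × X')}
    (hT : MeasurableSet T) {p : ENNReal} (h : ∀ y, μ {x | (x, y) ∈ T} ≤ p) :
    (μ.prod ν) T ≤ p := by
  rw [Measure.prod_apply_symm hT]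
  exact (lintegral_mono fun y => h y).trans (by simp)

/-- If `F` does not depend on the coordinates in `s` and `T y` depends on these coordinates only,
then the probability of `T (F w)` is at most the largest probability of the `T y`. -/
theorem measure_fresh_le (D : Measure Ξ) [IsProbabilityMeasure D] (s : Set ι)
    {F : (ι → Ξ) → Y} (hF : Measurable F) (hFs : ∀ w w', (∀ i ∉ s, w i = w' i) → F w = F w')
    {T : Y → Set (ι → Ξ)} (hT : MeasurableSet {q : Y × (ι → Ξ) | q.2 ∈ T q.1})
    (hTs : ∀ y w w', (∀ i ∈ s, w i = w' i) → (w ∈ T y ↔ w' ∈ T y)) {p : ENNReal}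
    (hp : ∀ y, (Measure.infinitePi fun _ : ι => D) (T y) ≤ p) :
    (Measure.infinitePi fun _ : ι => D) {w | w ∈ T (F w)} ≤ p := by
  classical
  have hm : MeasurableSet {w | w ∈ T (F w)} := (hF.prodMk measurable_id) hT
  -- After resampling the coordinates in `s`, `F` sees only the first copy and `T y` only the
  -- second, so Fubini with the first copy frozen applies.
  rw [← (measurePreserving_piecewise D s).measure_preimage hm.nullMeasurableSet]
  have heq : (fun q : (ι → Ξ) × (ι → Ξ) => s.piecewise q.2 q.1) ⁻¹' {w | w ∈ T (F w)} =
      {q | q.2 ∈ T (F q.1)} := by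
    ext ⟨w, w'⟩
    have h1 : F (s.piecewise w' w) = F w :=
      hFs _ _ fun i hi => Set.piecewise_eq_of_notMem _ _ _ hi
    have h2 := hTs (F w) (s.piecewise w' w) w' fun i hi => Set.piecewise_eq_of_mem _ _ _ hi
    simp only [Set.mem_preimage, Set.mem_ofPred_eq, h1]
    exact h2
  rw [heq]
  exact prod_le_of_forall_section_le _ _
    ((hF.comp measurable_fst).prodMk measurable_snd hT) fun w => hp (F w)

end Fresh


/-! ### Variance-reduced estimates -/

section Estimate

variable {n : ℕ} {Ξ E : Type*} [NormedAddCommGroup E] [NormedSpace ℝ E]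

/-- The variance-reduced estimate of the mean of a random map `H`; the value estimate and the
Jacobian estimate of the method are both of this form. -/
noncomputable def vrEstimate (H : Ξ → Vec n → E) (N₀ N₁ : ℕ) (ω : ℕ × ℕ × ℕ → Ξ) (k : ℕ)
    (x₀ : Vec n) (i : ℕ) (x : Vec n) : E :=
  if i = 0 then (N₀ : ℝ)⁻¹ • ∑ r ∈ Finset.range N₀, H (ω (k, 0, r)) x₀
  else (N₁ : ℝ)⁻¹ • ∑ r ∈ Finset.range N₁, (H (ω (k, i, r)) x - H (ω (k, i, r)) x₀) +
    (N₀ : ℝ)⁻¹ • ∑ r ∈ Finset.range N₀, H (ω (k, 0, r)) x₀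

/-- The samples of the batch `(k, i)` are bad at the points `q = (x₀, x)` if their average is off
by more than `t₀` (for `i = 0`) or `t₁ ‖x - x₀‖` (for `i > 0`). -/
def badBatch (H : Ξ → Vec n → E) (c : Vec n → E) (N₀ N₁ : ℕ) (t₀ t₁ : ℝ) (k i : ℕ)
    (q : Vec n × Vec n) : Set (ℕ × ℕ × ℕ → Ξ) :=
  {ω | if i = 0 then t₀ < ‖(N₀ : ℝ)⁻¹ • ∑ r ∈ Finset.range N₀, H (ω (k, i, r)) q.1 - c q.1‖
    else t₁ * ‖q.2 - q.1‖ < ‖(N₁ : ℝ)⁻¹ • ∑ r ∈ Finset.range N₁,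
      (H (ω (k, i, r)) q.2 - H (ω (k, i, r)) q.1) - (c q.2 - c q.1)‖}

/-- The error splits into that of the initial average at `x₀` and that of the averaged increment
from `x₀` to `x`. The point `x'` is arbitrary because for `i = 0` badness ignores the second point.
-/
theorem vrEstimate_error_le {H : Ξ → Vec n → E} {c : Vec n → E} {N₀ N₁ : ℕ} {t₀ t₁ : ℝ} {ω : ℕ × ℕ × ℕ → Ξ} {k i : ℕ} {x₀ x x' : Vec n} (hi : i = 0 → x = x₀)
    (h₀ : ω ∉ badBatch H c N₀ N₁ t₀ t₁ k 0 (x₀, x'))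
    (h₁ : ω ∉ badBatch H c N₀ N₁ t₀ t₁ k i (x₀, x)) :
    ‖vrEstimate H N₀ N₁ ω k x₀ i x - c x‖ ≤ t₀ + t₁ * ‖x - x₀‖ := by
  simp only [badBatch, Set.mem_ofPred_eq, if_true, not_lt] at h₀
  unfold vrEstimate
  split_ifs with h
  · rw [hi h]
    simpa using h₀
  · simp only [badBatch, Set.mem_ofPred_eq, if_neg h, not_lt] at h₁
    refine le_trans (le_of_eq ?_) ((norm_add_le _ _).trans (add_le_add h₀ h₁))
    congr 1
    abel

theorem mem_badBatch_congr {H : Ξ → Vec n → E} {c : Vec n → E} {N₀ N₁ : ℕ} {t₀ t₁ : ℝ} {k i : ℕ}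
    (q : Vec n × Vec n) {ω ω' : ℕ × ℕ × ℕ → Ξ} (h : ∀ r, ω (k, i, r) = ω' (k, i, r)) :
    ω ∈ badBatch H c N₀ N₁ t₀ t₁ k i q ↔ ω' ∈ badBatch H c N₀ N₁ t₀ t₁ k i q := by
  simp only [badBatch, Set.mem_ofPred_eq, h]

variable [MeasurableSpace Ξ] [MeasurableSpace E] [BorelSpace E] [SecondCountableTopology E]

theorem measurable_vrEstimate {H : Ξ → Vec n → E}
    (hH : Measurable fun q : Ξ × Vec n => H q.1 q.2) (N₀ N₁ k i : ℕ) :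
    Measurable fun q : (ℕ × ℕ × ℕ → Ξ) × Vec n × Vec n =>
      vrEstimate H N₀ N₁ q.1 k q.2.1 i q.2.2 := by
  have h1 : ∀ a, Measurable fun q : (ℕ × ℕ × ℕ → Ξ) × Vec n × Vec n => H (q.1 a) q.2.1 :=
    fun a => hH.comp (f := fun q : (ℕ × ℕ × ℕ → Ξ) × Vec n × Vec n => (q.1 a, q.2.1))
      (by fun_prop)
  have h2 : ∀ a, Measurable fun q : (ℕ × ℕ × ℕ → Ξ) × Vec n × Vec n => H (q.1 a) q.2.2 :=
    fun a => hH.comp (f := fun q : (ℕ × ℕ × ℕ → Ξ) × Vec n × Vec n => (q.1 a, q.2.2))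
      (by fun_prop)
  unfold vrEstimate
  split_ifs
  · exact (Finset.measurable_sum _ fun r _ => h1 _).const_smul _
  · exact ((Finset.measurable_sum _ fun r _ => (h2 _).sub (h1 _)).const_smul _).add
      ((Finset.measurable_sum _ fun r _ => h1 _).const_smul _)

theorem measurableSet_badBatch {H : Ξ → Vec n → E}
    (hH : Measurable fun q : Ξ × Vec n => H q.1 q.2) {c : Vec n → E} (hc : Measurable c)
    (N₀ N₁ : ℕ) (t₀ t₁ : ℝ) (k i : ℕ) :
    MeasurableSet {q : (Vec n × Vec n) × (ℕ × ℕ × ℕ → Ξ) |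
      q.2 ∈ badBatch H c N₀ N₁ t₀ t₁ k i q.1} := by
  have h1 : ∀ a, Measurable fun q : (Vec n × Vec n) × (ℕ × ℕ × ℕ → Ξ) => H (q.2 a) q.1.1 :=
    fun a => hH.comp (f := fun q : (Vec n × Vec n) × (ℕ × ℕ × ℕ → Ξ) => (q.2 a, q.1.1))
      (by fun_prop)
  have h2 : ∀ a, Measurable fun q : (Vec n × Vec n) × (ℕ × ℕ × ℕ → Ξ) => H (q.2 a) q.1.2 :=
    fun a => hH.comp (f := fun q : (Vec n × Vec n) × (ℕ × ℕ × ℕ → Ξ) => (q.2 a, q.1.2))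
      (by fun_prop)
  have hc1 : Measurable fun q : (Vec n × Vec n) × (ℕ × ℕ × ℕ → Ξ) => c q.1.1 :=
    hc.comp (measurable_fst.comp measurable_fst)
  have hc2 : Measurable fun q : (Vec n × Vec n) × (ℕ × ℕ × ℕ → Ξ) => c q.1.2 :=
    hc.comp (measurable_snd.comp measurable_fst)
  unfold badBatch
  simp only [Set.mem_ofPred_eq]
  split_ifs
  · exact measurableSet_lt measurable_const
      (((Finset.measurable_sum _ fun r _ => h1 _).const_smul _).sub hc1).norm
  · exact measurableSet_lt (by fun_prop)
      (((Finset.measurable_sum _ fun r _ => (h2 _).sub (h1 _)).const_smul _).sub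
        (hc2.sub hc1)).norm

/-- A fresh batch is bad with small probability. -/
theorem measure_badBatch_le [CompleteSpace E] (D : Measure Ξ) [IsProbabilityMeasure D]
    {U : Finset (E →L[ℝ] ℝ)} (hU : ∀ u ∈ U, ‖u‖ ≤ 1) (hU' : ∀ z : E, ∃ u ∈ U, ‖z‖ ≤ 2 * u z)
    {H : Ξ → Vec n → E} (hH : Measurable fun q : Ξ × Vec n => H q.1 q.2)
    (hint : ∀ x, Integrable (fun ξ => H ξ x) D) {c : Vec n → E} (hc : ∀ x, ∫ ξ, H ξ x ∂D = c x)
    {σ ℓ : ℝ} (hσ : 0 < σ) (hℓ : 0 < ℓ) (hdev : ∀ᵐ ξ ∂D, ∀ x, ‖H ξ x - c x‖ ≤ σ)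
    (hlip : ∀ᵐ ξ ∂D, ∀ x y, ‖H ξ x - H ξ y‖ ≤ ℓ * ‖x - y‖)
    {N₀ N₁ : ℕ} {t₀ t₁ p : ℝ} (ht₀ : 0 ≤ t₀) (ht₁ : 0 ≤ t₁)
    (hp₀ : U.card * Real.exp (-(N₀ * t₀ ^ 2 / (8 * σ ^ 2))) ≤ p)
    (hp₁ : U.card * Real.exp (-(N₁ * t₁ ^ 2 / (32 * ℓ ^ 2))) ≤ p) (k i : ℕ) (q : Vec n × Vec n) :
    (Measure.infinitePi fun _ : ℕ × ℕ × ℕ => D) (badBatch H c N₀ N₁ t₀ t₁ k i q) ≤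
      ENNReal.ofReal p := by
  have hHx : ∀ x, Measurable fun ξ => H ξ x := fun x => hH.comp measurable_prodMk_right
  have hj : Function.Injective fun r : ℕ => (k, i, r) := fun a b hab => by simpa using hab
  rw [← ENNReal.ofReal_toReal (measure_ne_top (Measure.infinitePi fun _ : ℕ × ℕ × ℕ => D)
    (badBatch H c N₀ N₁ t₀ t₁ k i q))]
  refine ENNReal.ofReal_le_ofReal ?_
  change (Measure.infinitePi fun _ : ℕ × ℕ × ℕ => D).real _ ≤ p
  unfold badBatch
  split_ifs with hi
  · refine le_trans ?_ hp₀
    exact measure_average_sub_gt_le D hU hU' (hHx q.1) (hint q.1) (hc q.1) hσ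
      (hdev.mono fun ξ hξ => hξ q.1) N₀ hj ht₀
  -- With coinciding points the event is empty; this case is separate because Hoeffding needs a
  -- positive radius.
  · rcases eq_or_ne q.2 q.1 with heq | hne
    · have : (0 : ℝ) ≤ U.card * Real.exp (-(N₁ * t₁ ^ 2 / (32 * ℓ ^ 2))) := by positivity
      simpa [heq] using this.trans hp₁
    refine le_trans ?_ hp₁
    have hpos : 0 < ‖q.2 - q.1‖ := norm_pos_iff.2 (sub_ne_zero.2 hne)
    have hmean : ∫ ξ, (H ξ q.2 - H ξ q.1) ∂D = c q.2 - c q.1 := by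
      rw [integral_sub (hint _) (hint _), hc, hc]
    have hcl : ‖c q.2 - c q.1‖ ≤ ℓ * ‖q.2 - q.1‖ := by
      rw [← hmean]
      refine (norm_integral_le_of_norm_le_const (hlip.mono fun ξ hξ => hξ q.2 q.1)).trans ?_
      simp
    -- The centred increment has norm at most `2ℓ‖q.2 - q.1‖`. Radius and threshold scale alike with
    -- the distance, so it cancels, and `8(2ℓ)² = 32ℓ²`.
    have key := measure_average_sub_gt_le D hU hU' (Y := fun ξ => H ξ q.2 - H ξ q.1)
      ((hHx q.2).sub (hHx q.1)) ((hint q.2).sub (hint q.1)) hmean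
      (R := 2 * ℓ * ‖q.2 - q.1‖) (by positivity)
      (hlip.mono fun ξ hξ => by
        refine (norm_sub_le _ _).trans ?_
        linarith [hξ q.2 q.1]) N₁ hj (t := t₁ * ‖q.2 - q.1‖) (by positivity)
    refine key.trans (le_of_eq ?_)
    congr 3
    field_simp
    ring

end Estimate

/-! ### Moments of the oracle -/

section OracleMoments

variable {m n : ℕ} {Ξ : Type*} [MeasurableSpace Ξ] {D : Measure Ξ}
  {G : Ξ → Vec n → Vec m} {lhat Lhat : ℝ}

/-- Supplies the dominating constant for differentiation under the integral; the absolute value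
spares a sign assumption on `lhat`. -/
theorem norm_fderiv_le_abs (hG : UniformLipschitz D G lhat Lhat) :
    ∀ᵐ ξ ∂D, ∀ x, ‖fderiv ℝ (G ξ) x‖ ≤ |lhat| := by
  filter_upwards [hG.value] with ξ hξ x
  have : LipschitzWith (Real.toNNReal |lhat|) (G ξ) :=
    LipschitzWith.of_dist_le_mul fun a b => by
      rw [dist_eq_norm, dist_eq_norm, Real.coe_toNNReal _ (abs_nonneg _)]
      exact (hξ a b).trans (mul_le_mul_of_nonneg_right (le_abs_self _) (norm_nonneg _))
  simpa using norm_fderiv_le_of_lipschitz ℝ this (x₀ := x)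

theorem integrable_fderiv [IsProbabilityMeasure D] (hO : OracleRegularity D G) (hG : UniformLipschitz D G lhat Lhat)
    (x : Vec n) : Integrable (fun ξ => fderiv ℝ (G ξ) x) D :=
  Integrable.of_bound (hO.measurable_jacobian.comp measurable_prodMk_right).aestronglyMeasurable
    |lhat| ((norm_fderiv_le_abs hG).mono fun _ hξ => hξ x)

/-- The sampled Jacobians are unbiased. -/
theorem integral_fderiv [IsProbabilityMeasure D] (hO : OracleRegularity D G) (hG : UniformLipschitz D G lhat Lhat)
    (x : Vec n) : ∫ ξ, fderiv ℝ (G ξ) x ∂D = fderiv ℝ (innerMap D G) x := by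
  refine (HasFDerivAt.fderiv ?_).symm
  refine hasFDerivAt_integral_of_dominated_of_fderiv_le (F := fun x ξ => G ξ x)
    (F' := fun x ξ => fderiv ℝ (G ξ) x) (bound := fun _ => |lhat|) (s := Set.univ)
    Filter.univ_mem (Filter.Eventually.of_forall fun y => (hO.integrable y).aestronglyMeasurable)
    (hO.integrable x) (integrable_fderiv hO hG x).aestronglyMeasurable ?_
    (integrable_const _) ?_
  · exact (norm_fderiv_le_abs hG).mono fun ξ hξ y _ => hξ y
  · exact hO.differentiable.mono fun ξ hξ y _ => (hξ y).hasFDerivAt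

end OracleMoments


/-! ### Measurability and locality of the iterates -/

section Iterates

variable {m n : ℕ} {Ξ Seed : Type*} {f : Vec m → ℝ} {h : Vec n → EReal}
  {G : Ξ → Vec n → Vec m} {M : ℝ} {solver : Solver n Seed} {ebar dbar : ℝ} {N : BatchSizes}
  {xinit : Vec n}

theorem valueEstimate_eq (w : Inputs Ξ Seed) (k : ℕ) (x₀ : Vec n) (i : ℕ) (x : Vec n) :
    valueEstimate G N w k x₀ i x = vrEstimate G N.A N.a w.2.1 k x₀ i x := rfl

theorem jacobianEstimate_eq (w : Inputs Ξ Seed) (k : ℕ) (x₀ : Vec n) (i : ℕ) (x : Vec n) :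
    jacobianEstimate G N w k x₀ i x =
      vrEstimate (fun ξ => fderiv ℝ (G ξ)) N.B N.b w.2.2.1 k x₀ i x := rfl

theorem vrEstimate_congr {E : Type*} [NormedAddCommGroup E] [NormedSpace ℝ E] {H : Ξ → Vec n → E}
    {N₀ N₁ : ℕ} {ω ω' : ℕ × ℕ × ℕ → Ξ} {k i : ℕ} (x₀ x : Vec n)
    (h₀ : ∀ r, ω (k, 0, r) = ω' (k, 0, r)) (hi : ∀ r, ω (k, i, r) = ω' (k, i, r)) :
    vrEstimate H N₀ N₁ ω k x₀ i x = vrEstimate H N₀ N₁ ω' k x₀ i x := by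
  simp only [vrEstimate, h₀, hi]

/-- Two inputs agree at the iteration `(k, i)`. -/
structure AgreeAt (w w' : Inputs Ξ Seed) (k i : ℕ) : Prop where
  value : ∀ r, w.2.1 (k, i, r) = w'.2.1 (k, i, r)
  jacobian : ∀ r, w.2.2.1 (k, i, r) = w'.2.2.1 (k, i, r)
  seed : w.2.2.2 (k, i) = w'.2.2.2 (k, i)

/-- Causality: the `i`-th point of an epoch uses only the batches and seeds of its iterations before
`i`. This is what makes the batch `(k, i)` fresh. -/
theorem innerIterate_congr {w w' : Inputs Ξ Seed} (k : ℕ) (x₀ : Vec n) (i : ℕ)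
    (hw : ∀ i' < i, AgreeAt w w' k i') :
    innerIterate f h G M solver ebar dbar N w k x₀ i =
      innerIterate f h G M solver ebar dbar N w' k x₀ i := by
  induction i with
  | zero => rfl
  | succ i ih =>
    have h1 := ih fun i' hi' => hw i' (hi'.trans i.lt_succ_self)
    have h0 := hw 0 i.succ_pos
    have h2 := hw i i.lt_succ_self
    simp only [innerIterate]
    rw [h1, valueEstimate_eq, valueEstimate_eq, jacobianEstimate_eq, jacobianEstimate_eq,
      vrEstimate_congr _ _ h0.value h2.value, vrEstimate_congr _ _ h0.jacobian h2.jacobian, h2.seed]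

theorem epochStart_congr {w w' : Inputs Ξ Seed} (hτ : w.1 = w'.1) (k : ℕ)
    (hw : ∀ k' < k, ∀ i, AgreeAt w w' k' i) :
    epochStart f h G M solver ebar dbar N xinit w k =
      epochStart f h G M solver ebar dbar N xinit w' k := by
  induction k with
  | zero => rfl
  | succ k ih =>
    simp only [epochStart]
    rw [ih fun k' hk' => hw k' (hk'.trans k.lt_succ_self), hτ]
    exact innerIterate_congr _ _ _ fun i' _ => hw k k.lt_succ_self i'

theorem iterate_congr {w w' : Inputs Ξ Seed} (hτ : w.1 = w'.1) (k i : ℕ)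
    (hw : ∀ k' i', k' < k ∨ k' = k ∧ i' < i → AgreeAt w w' k' i') :
    iterate f h G M solver ebar dbar N xinit w k i =
      iterate f h G M solver ebar dbar N xinit w' k i := by
  unfold iterate
  rw [epochStart_congr hτ k fun k' hk' i' => hw k' i' (Or.inl hk')]
  exact innerIterate_congr _ _ _ fun i' hi' => hw k i' (Or.inr ⟨rfl, hi'⟩)

/-- The data `(x, v, J)` of the subproblem that is solved at the iteration `(k, i)`. -/
noncomputable def subproblemData (f : Vec m → ℝ) (h : Vec n → EReal) (G : Ξ → Vec n → Vec m)
    (M : ℝ) (solver : Solver n Seed) (ebar dbar : ℝ) (N : BatchSizes) (xinit : Vec n)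
    (w : Inputs Ξ Seed) (k i : ℕ) : Vec n × Vec m × (Vec n →L[ℝ] Vec m) :=
  let x₀ := epochStart f h G M solver ebar dbar N xinit w k
  let x := iterate f h G M solver ebar dbar N xinit w k i
  (x, vrEstimate G N.A N.a w.2.1 k x₀ i x,
    vrEstimate (fun ξ => fderiv ℝ (G ξ)) N.B N.b w.2.2.1 k x₀ i x)

theorem iterate_succ (w : Inputs Ξ Seed) (k i : ℕ) :
    iterate f h G M solver ebar dbar N xinit w k (i + 1) =
      solver (subproblem f h M
        (subproblemData f h G M solver ebar dbar N xinit w k i).1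
        (subproblemData f h G M solver ebar dbar N xinit w k i).2.1
        (subproblemData f h G M solver ebar dbar N xinit w k i).2.2) ebar dbar
        (w.2.2.2 (k, i)) := rfl

/-- The seed `(k, i)` is consumed only after the subproblem `(k, i)` has been formed, so that
subproblem is independent of it. -/
theorem subproblemData_congr {w w' : Inputs Ξ Seed} (hτ : w.1 = w'.1) (hA : w.2.1 = w'.2.1)
    (hB : w.2.2.1 = w'.2.2.1) (k i : ℕ)
    (hS : ∀ q, q ≠ (k, i) → w.2.2.2 q = w'.2.2.2 q) :
    subproblemData f h G M solver ebar dbar N xinit w k i =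
      subproblemData f h G M solver ebar dbar N xinit w' k i := by
  have hag : ∀ k' i', (k', i') ≠ (k, i) → AgreeAt w w' k' i' := fun k' i' hne =>
    ⟨fun r => by rw [hA], fun r => by rw [hB], hS _ hne⟩
  have h0 : epochStart f h G M solver ebar dbar N xinit w k =
      epochStart f h G M solver ebar dbar N xinit w' k :=
    epochStart_congr hτ k fun k' hk' i' => hag k' i' (by simp [hk'.ne])
  have h1 : iterate f h G M solver ebar dbar N xinit w k i =
      iterate f h G M solver ebar dbar N xinit w' k i :=
    iterate_congr hτ k i fun k' i' hlt => hag k' i' (by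
      rcases hlt with hlt | ⟨-, hlt⟩
      · simp [hlt.ne]
      · simp [hlt.ne])
  simp only [subproblemData]
  rw [h0, h1, hA, hB]

variable [MeasurableSpace Ξ] [MeasurableSpace Seed]

theorem measurable_innerIterate {D : Measure Ξ} {Q : Measure Seed} (hO : OracleRegularity D G)
    (hsol : SolverAssumption f h M Q solver) (he : 0 < ebar) (hd : 0 < dbar) (k i : ℕ) :
    Measurable fun q : Inputs Ξ Seed × Vec n =>
      innerIterate f h G M solver ebar dbar N q.1 k q.2 i := by
  induction i with
  | zero => exact measurable_snd
  | succ i ih =>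
    have hv : Measurable fun q : Inputs Ξ Seed × Vec n =>
        vrEstimate G N.A N.a q.1.2.1 k q.2 i
          (innerIterate f h G M solver ebar dbar N q.1 k q.2 i) :=
      (measurable_vrEstimate hO.measurable_value N.A N.a k i).comp
        (f := fun q : Inputs Ξ Seed × Vec n => (q.1.2.1, q.2,
          innerIterate f h G M solver ebar dbar N q.1 k q.2 i))
        (Measurable.prodMk (by fun_prop) (Measurable.prodMk (by fun_prop) ih))
    have hJ : Measurable fun q : Inputs Ξ Seed × Vec n =>
        vrEstimate (fun ξ => fderiv ℝ (G ξ)) N.B N.b q.1.2.2.1 k q.2 i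
          (innerIterate f h G M solver ebar dbar N q.1 k q.2 i) :=
      (measurable_vrEstimate (H := fun ξ => fderiv ℝ (G ξ)) hO.measurable_jacobian N.B N.b k i).comp
        (f := fun q : Inputs Ξ Seed × Vec n => (q.1.2.2.1, q.2,
          innerIterate f h G M solver ebar dbar N q.1 k q.2 i))
        (Measurable.prodMk (by fun_prop) (Measurable.prodMk (by fun_prop) ih))
    exact (hsol.measurable ebar dbar he hd).comp
      (f := fun q : Inputs Ξ Seed × Vec n =>
        ((innerIterate f h G M solver ebar dbar N q.1 k q.2 i,
          vrEstimate G N.A N.a q.1.2.1 k q.2 i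
            (innerIterate f h G M solver ebar dbar N q.1 k q.2 i),
          vrEstimate (fun ξ => fderiv ℝ (G ξ)) N.B N.b q.1.2.2.1 k q.2 i
            (innerIterate f h G M solver ebar dbar N q.1 k q.2 i)), q.1.2.2.2 (k, i)))
      ((ih.prodMk (hv.prodMk hJ)).prodMk (by fun_prop))

theorem measurable_epochStart {D : Measure Ξ} {Q : Measure Seed} (hO : OracleRegularity D G)
    (hsol : SolverAssumption f h M Q solver) (he : 0 < ebar) (hd : 0 < dbar) (k : ℕ) :
    Measurable fun w : Inputs Ξ Seed => epochStart f h G M solver ebar dbar N xinit w k := by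
  induction k with
  | zero => exact measurable_const
  | succ k ih =>
    have h1 : Measurable fun q : ℕ × Inputs Ξ Seed => innerIterate f h G M solver ebar dbar N q.2 k
        (epochStart f h G M solver ebar dbar N xinit q.2 k) q.1 :=
      -- The epoch ends at a random index; as indices are countable, measurability at each fixed
      -- index is enough.
      measurable_from_prod_countable_right fun i =>
        (measurable_innerIterate hO hsol he hd k i).comp
          (f := fun w : Inputs Ξ Seed => (w, epochStart f h G M solver ebar dbar N xinit w k))
          (measurable_id.prodMk ih)
    exact h1.comp (f := fun w : Inputs Ξ Seed => (w.1 k, w)) (by fun_prop)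

theorem measurable_iterate {D : Measure Ξ} {Q : Measure Seed} (hO : OracleRegularity D G)
    (hsol : SolverAssumption f h M Q solver) (he : 0 < ebar) (hd : 0 < dbar) (k i : ℕ) :
    Measurable fun w : Inputs Ξ Seed => iterate f h G M solver ebar dbar N xinit w k i :=
  (measurable_innerIterate hO hsol he hd k i).comp
    (f := fun w : Inputs Ξ Seed => (w, epochStart f h G M solver ebar dbar N xinit w k))
    (measurable_id.prodMk (measurable_epochStart hO hsol he hd k))

theorem measurable_subproblemData {D : Measure Ξ} {Q : Measure Seed} (hO : OracleRegularity D G)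
    (hsol : SolverAssumption f h M Q solver) (he : 0 < ebar) (hd : 0 < dbar) (k i : ℕ) :
    Measurable fun w : Inputs Ξ Seed =>
      subproblemData f h G M solver ebar dbar N xinit w k i := by
  have h0 := measurable_epochStart (N := N) (xinit := xinit) hO hsol he hd k
  have h1 := measurable_iterate (N := N) (xinit := xinit) hO hsol he hd k i
  refine h1.prodMk (Measurable.prodMk ?_ ?_)
  · exact (measurable_vrEstimate hO.measurable_value N.A N.a k i).comp
      (f := fun w : Inputs Ξ Seed => (w.2.1, epochStart f h G M solver ebar dbar N xinit w k,
        iterate f h G M solver ebar dbar N xinit w k i))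
      (Measurable.prodMk (by fun_prop) (h0.prodMk h1))
  · exact (measurable_vrEstimate (H := fun ξ => fderiv ℝ (G ξ)) hO.measurable_jacobian N.B N.b k i).comp
      (f := fun w : Inputs Ξ Seed => (w.2.2.1, epochStart f h G M solver ebar dbar N xinit w k,
        iterate f h G M solver ebar dbar N xinit w k i))
      (Measurable.prodMk (by fun_prop) (h0.prodMk h1))

end Iterates

/-! ### Failures of the solver -/

section SolverFailure

variable {m n : ℕ} {f : Vec m → ℝ} {h : Vec n → EReal} {M : ℝ}

theorem continuous_smoothPart (hf : Continuous f) :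
    Continuous fun q : (Vec n × Vec m × (Vec n →L[ℝ] Vec m)) × Vec n =>
      smoothPart f M q.1.1 q.1.2.1 q.1.2.2 q.2 := by
  unfold smoothPart
  have h1 : Continuous fun q : (Vec n × Vec m × (Vec n →L[ℝ] Vec m)) × Vec n =>
      q.1.2.2 (q.2 - q.1.1) := by fun_prop
  fun_prop

theorem measurable_subproblem (hf : Continuous f) (hh : ClosedConvexProper h) :
    Measurable fun q : (Vec n × Vec m × (Vec n →L[ℝ] Vec m)) × Vec n =>
      subproblem f h M q.1.1 q.1.2.1 q.1.2.2 q.2 :=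
  (measurable_coe_real_ereal.comp (continuous_smoothPart hf).measurable).add
    (hh.lowerSemicontinuous.measurable.comp measurable_snd)

/-- The infimum is over uncountably many `y`, but for each `y` the model is continuous in the data,
or constantly `⊤`; an infimum of continuous functions is upper semicontinuous. -/
theorem measurable_iInf_subproblem (hf : Continuous f) (hh : ClosedConvexProper h) :
    Measurable fun q : Vec n × Vec m × (Vec n →L[ℝ] Vec m) =>
      ⨅ y, subproblem f h M q.1 q.2.1 q.2.2 y := by
  refine UpperSemicontinuous.measurable (upperSemicontinuous_iInf fun y => ?_)
  refine Continuous.upperSemicontinuous ?_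
  by_cases hy : h y = ⊤
  · simp only [subproblem_eq, hy, EReal.coe_add_top]
    exact continuous_const
  · obtain ⟨b, hb⟩ := hh.eq_coe hy
    simp only [subproblem_of_eq_coe _ _ _ hb]
    refine continuous_coe_real_ereal.comp ?_
    exact ((continuous_smoothPart hf).comp
      (f := fun q : Vec n × Vec m × (Vec n →L[ℝ] Vec m) => (q, y)) (by fun_prop)).add
        continuous_const

variable {Seed : Type*} [MeasurableSpace Seed] {Q : Measure Seed}
  {solver : Solver n Seed}

/-- The seeds at which the solver fails on the subproblem with data `q`. -/
def badSeeds (f : Vec m → ℝ) (h : Vec n → EReal) (M : ℝ) (solver : Solver n Seed)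
    (ebar dbar : ℝ) (q : Vec n × Vec m × (Vec n →L[ℝ] Vec m)) : Set Seed :=
  {u | ¬ subproblem f h M q.1 q.2.1 q.2.2
      (solver (subproblem f h M q.1 q.2.1 q.2.2) ebar dbar u) ≤
    (⨅ y, subproblem f h M q.1 q.2.1 q.2.2 y) + (ebar : EReal)}

theorem measurableSet_badSeeds (hf : Continuous f) (hh : ClosedConvexProper h)
    (hsol : SolverAssumption f h M Q solver) {ebar dbar : ℝ} (he : 0 < ebar) (hd : 0 < dbar) :
    MeasurableSet {q : (Vec n × Vec m × (Vec n →L[ℝ] Vec m)) × Seed |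
      q.2 ∈ badSeeds f h M solver ebar dbar q.1} := by
  have h1 : Measurable fun q : (Vec n × Vec m × (Vec n →L[ℝ] Vec m)) × Seed =>
      subproblem f h M q.1.1 q.1.2.1 q.1.2.2
        (solver (subproblem f h M q.1.1 q.1.2.1 q.1.2.2) ebar dbar q.2) :=
    (measurable_subproblem hf hh).comp
      (f := fun q : (Vec n × Vec m × (Vec n →L[ℝ] Vec m)) × Seed =>
        (q.1, solver (subproblem f h M q.1.1 q.1.2.1 q.1.2.2) ebar dbar q.2))
      (measurable_fst.prodMk (hsol.measurable ebar dbar he hd))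
  have h2 : Measurable fun q : (Vec n × Vec m × (Vec n →L[ℝ] Vec m)) × Seed =>
      (⨅ y, subproblem f h M q.1.1 q.1.2.1 q.1.2.2 y) + (ebar : EReal) :=
    ((measurable_iInf_subproblem hf hh).comp measurable_fst).add measurable_const
  exact (measurableSet_le h1 h2).compl

theorem measure_badSeeds_le [IsProbabilityMeasure Q] (hf : Continuous f)
    (hh : ClosedConvexProper h) (hsol : SolverAssumption f h M Q solver) {ebar dbar : ℝ}
    (he : 0 < ebar) (hd : 0 < dbar) (q : Vec n × Vec m × (Vec n →L[ℝ] Vec m)) :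
    Q (badSeeds f h M solver ebar dbar q) ≤ ENNReal.ofReal dbar := by
  have hm : MeasurableSet (badSeeds f h M solver ebar dbar q) :=
    measurable_prodMk_left (x := q) (measurableSet_badSeeds hf hh hsol he hd)
  have h1 := hsol.approx_optimal ebar dbar he hd q.1 q.2.1 q.2.2
  have h2 := measureReal_compl (μ := Q) hm
  have h3 : (badSeeds f h M solver ebar dbar q)ᶜ = {u | subproblem f h M q.1 q.2.1 q.2.2
      (solver (subproblem f h M q.1 q.2.1 q.2.2) ebar dbar u) ≤
    (⨅ y, subproblem f h M q.1 q.2.1 q.2.2 y) + (ebar : EReal)} := by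
    ext u
    simp [badSeeds]
  rw [← h3, h2] at h1
  rw [← ENNReal.ofReal_toReal (measure_ne_top Q (badSeeds f h M solver ebar dbar q))]
  refine ENNReal.ofReal_le_ofReal ?_
  change Q.real _ ≤ dbar
  rw [probReal_univ] at h1
  linarith

end SolverFailure


/-! ### Epochs -/

section Epochs

variable {S : ℕ} {τ : ℕ → ℕ}

theorem le_sum_of_one_le (hτ : ∀ k, 1 ≤ τ k) (N : ℕ) : N ≤ ∑ k ∈ Finset.range N, τ k := by
  simpa using Finset.card_nsmul_le_sum (Finset.range N) τ 1 fun k _ => hτ k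

/-- Lengths at least `1` make the set defining `epochCount` nonempty, so its `sInf` is attained and
is not the default `0`. -/
theorem le_totalIterations (hτ : ∀ k, 1 ≤ τ k) : S ≤ totalIterations S τ :=
  Nat.sInf_mem (s := {N | S ≤ ∑ k ∈ Finset.range N, τ k}) ⟨S, le_sum_of_one_le hτ S⟩

theorem sum_lt_of_lt_epochCount {k : ℕ} (hk : k < epochCount S τ) :
    ∑ j ∈ Finset.range k, τ j < S :=
  not_le.1 (Nat.notMem_of_lt_sInf (s := {N | S ≤ ∑ k ∈ Finset.range N, τ k}) hk)

theorem lt_epochCount_of_sum_lt (hτ : ∀ k, 1 ≤ τ k) {k : ℕ}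
    (hk : ∑ j ∈ Finset.range k, τ j < S) : k < epochCount S τ := by
  by_contra hle
  have h1 := le_totalIterations (S := S) hτ
  have h2 : totalIterations S τ ≤ ∑ j ∈ Finset.range k, τ j :=
    Finset.sum_le_sum_of_subset (Finset.range_mono (not_lt.1 hle))
  omega

/-- Before the last epoch the count is below `S`, so the overshoot is at most one epoch length. -/
theorem totalIterations_le {τplus : ℕ} (hτ : ∀ k, τ k ≤ τplus) :
    totalIterations S τ ≤ S + τplus := by
  unfold totalIterations
  rcases hK : epochCount S τ with _ | K
  · simp
  · have h1 := sum_lt_of_lt_epochCount (S := S) (τ := τ) (k := K) (by omega)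
    have h2 := hτ K
    rw [Finset.sum_range_succ]
    omega

theorem epochCount_le {N : ℕ} (hN : S ≤ ∑ k ∈ Finset.range N, τ k) : epochCount S τ ≤ N :=
  Nat.sInf_le hN

theorem sum_calls_le (A a S : ℕ) (τ : ℕ → ℕ) :
    ∑ k ∈ Finset.range (epochCount S τ), ∑ i ∈ Finset.range (τ k), (if i = 0 then A else 2 * a) ≤
      A * epochCount S τ + 2 * a * totalIterations S τ := by
  have h1 : ∀ T : ℕ, ∑ i ∈ Finset.range T, (if i = 0 then A else 2 * a) ≤ A + 2 * a * T := by
    intro T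
    rcases T with _ | T
    · simp
    · rw [Finset.sum_range_succ']
      simp only [Nat.add_eq_zero_iff, one_ne_zero, and_false, if_false, if_true,
        Finset.sum_const, Finset.card_range, smul_eq_mul]
      nlinarith
  refine (Finset.sum_le_sum fun k _ => h1 (τ k)).trans ?_
  rw [Finset.sum_add_distrib, Finset.sum_const, Finset.card_range, ← Finset.mul_sum,
    smul_eq_mul, mul_comm A]
  rfl

variable {ν : PMF ℕ} {τplus : ℕ}

theorem ae_mem_Icc (hν : ν.support ⊆ Set.Icc 1 τplus) :
    ∀ᵐ t ∂ν.toMeasure, 1 ≤ t ∧ t ≤ τplus := by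
  rw [ae_iff, PMF.toMeasure_apply_eq_zero_iff _ (MeasurableSet.of_discrete)]
  refine Set.disjoint_left.2 fun t ht hbad => hbad (hν ht)

theorem ae_forall_mem_Icc (hν : ν.support ⊆ Set.Icc 1 τplus) :
    ∀ᵐ τ ∂(Measure.infinitePi fun _ : ℕ => ν.toMeasure), ∀ k, 1 ≤ τ k ∧ τ k ≤ τplus :=
  ae_all_iff.2 fun k => (measurePreserving_eval_infinitePi
    (fun _ : ℕ => ν.toMeasure) k).quasiMeasurePreserving.ae (ae_mem_Icc hν)

/-- Sums of many independent epoch lengths are large. -/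
theorem measure_sum_lt_le (hν : ν.support ⊆ Set.Icc 1 τplus) (hτ : 1 ≤ τplus) {C : ℝ} (hC : 0 < C)
    (hmean : (τplus : ℝ) ≤ C * ∫ t, (t : ℝ) ∂ν.toMeasure) {N : ℕ}
    (hN : (S : ℝ) ≤ N * τplus / (2 * C)) :
    (Measure.infinitePi fun _ : ℕ => ν.toMeasure).real
      {τ | ∑ k ∈ Finset.range N, τ k < S} ≤ Real.exp (-(N / (8 * C ^ 2))) := by
  set c : ℝ := ∫ t, (t : ℝ) ∂ν.toMeasure with hc
  have hτ0 : (0 : ℝ) < τplus := by exact_mod_cast hτ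
  have hae := ae_mem_Icc hν
  have hb : ∀ᵐ t : ℕ ∂ν.toMeasure, ‖(t : ℝ)‖ ≤ (τplus : ℝ) := by
    filter_upwards [hae] with t ht
    rw [Real.norm_of_nonneg (Nat.cast_nonneg t)]
    exact_mod_cast ht.2
  have hm : Measurable fun t : ℕ => (t : ℝ) := measurable_of_countable _
  have hint : Integrable (fun t : ℕ => (t : ℝ)) ν.toMeasure :=
    Integrable.of_bound hm.aestronglyMeasurable _ hb
  have hcpos : 0 < c := pos_of_mul_pos_right (hτ0.trans_le hmean) hC.le
  have hcle : c ≤ τplus := by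
    have := norm_integral_le_of_norm_le_const hb
    simp only [probReal_univ, mul_one] at this
    exact (le_abs_self _).trans this
  have hdev : ∀ᵐ t : ℕ ∂ν.toMeasure, ‖(t : ℝ) - c‖ ≤ (τplus : ℝ) := by
    filter_upwards [hae] with t ht
    have h1 : (t : ℝ) ≤ τplus := by exact_mod_cast ht.2
    have h2 : (0 : ℝ) ≤ t := Nat.cast_nonneg t
    rw [Real.norm_eq_abs, abs_le]
    constructor <;> linarith
  -- The lower tail comes from the functional `-id`. Taking `t` equal to the mean `c` asks for a
  -- drop of `N c/2`, and `S ≤ N c/2`.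
  have key := measure_sum_dual_ge_le (ι := ℕ) ν.toMeasure (-ContinuousLinearMap.id ℝ ℝ)
    (by rw [norm_neg]; exact ContinuousLinearMap.norm_id_le) hm hint hc.symm hτ0 hdev N
    (j := fun k => k) (fun _ _ hab => hab) (t := c) hcpos.le
  refine (measureReal_mono ?_ (measure_ne_top _ _)).trans (key.trans ?_)
  · intro τ hτS
    have hτS' : ((∑ k ∈ Finset.range N, τ k : ℕ) : ℝ) < S := by exact_mod_cast hτS
    push_cast at hτS'
    have h1 : (N : ℝ) * τplus / (2 * C) ≤ N * c / 2 := by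
      rw [div_le_div_iff₀ (by positivity) (by positivity)]
      have := mul_le_mul_of_nonneg_left hmean (Nat.cast_nonneg (α := ℝ) N)
      nlinarith
    change (N : ℝ) * c / 2 ≤ ∑ r ∈ Finset.range N, (-ContinuousLinearMap.id ℝ ℝ) ((τ r : ℝ) - c)
    have h2 : ∑ r ∈ Finset.range N, (-ContinuousLinearMap.id ℝ ℝ) ((τ r : ℝ) - c) =
        N * c - ∑ r ∈ Finset.range N, (τ r : ℝ) := by
      simp
    rw [h2]
    linarith
  · refine Real.exp_le_exp.2 (neg_le_neg ?_)
    rw [div_le_div_iff₀ (by positivity) (by positivity)]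
    -- The exponent `N c² / (8 τ₊²)` is at least `N / (8 C²)` since `τ₊ ≤ C c`.
    have h1 : (τplus : ℝ) ^ 2 ≤ (C * c) ^ 2 := pow_le_pow_left₀ hτ0.le hmean 2
    have h2 := mul_le_mul_of_nonneg_left h1 (Nat.cast_nonneg (α := ℝ) N)
    nlinarith

end Epochs

/-! ### Bad events along the run -/

section BadEvents

variable {m n : ℕ} {Ξ Seed : Type*} [MeasurableSpace Ξ] [MeasurableSpace Seed]

/-- The law of the inputs other than the epoch lengths. -/
noncomputable def sampleLaw (D : Measure Ξ) [IsProbabilityMeasure D] (Q : Measure Seed)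
    [IsProbabilityMeasure Q] :
    Measure ((ℕ × ℕ × ℕ → Ξ) × (ℕ × ℕ × ℕ → Ξ) × (ℕ × ℕ → Seed)) :=
  (Measure.infinitePi fun _ : ℕ × ℕ × ℕ => D).prod
    ((Measure.infinitePi fun _ : ℕ × ℕ × ℕ => D).prod (Measure.infinitePi fun _ : ℕ × ℕ => Q))

variable {D : Measure Ξ} [IsProbabilityMeasure D] {Q : Measure Seed} [IsProbabilityMeasure Q]

instance : IsProbabilityMeasure (sampleLaw D Q) := by unfold sampleLaw; infer_instance

/-- Union bound over the iterations of the method, whose number is random but independent of the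
samples. -/
theorem inputLaw_exists_bad_le {ν : PMF ℕ} {τplus : ℕ} (hν : ν.support ⊆ Set.Icc 1 τplus)
    (S : ℕ) {Bad : ℕ → ℕ → Set (Inputs Ξ Seed)} (hBad : ∀ k i, MeasurableSet (Bad k i))
    {p : ENNReal} (hp : ∀ τ k i, sampleLaw D Q {r | ((τ, r) : Inputs Ξ Seed) ∈ Bad k i} ≤ p) :
    inputLaw ν D Q {w | ∃ k i, ∑ j ∈ Finset.range k, w.1 j < S ∧ i < w.1 k ∧ w ∈ Bad k i} ≤
      (S + τplus : ℕ) * p := by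
  have hm : MeasurableSet {w : Inputs Ξ Seed |
      ∃ k i, ∑ j ∈ Finset.range k, w.1 j < S ∧ i < w.1 k ∧ w ∈ Bad k i} := by
    have : {w : Inputs Ξ Seed |
        ∃ k i, ∑ j ∈ Finset.range k, w.1 j < S ∧ i < w.1 k ∧ w ∈ Bad k i} =
        ⋃ k, ⋃ i, {w | ∑ j ∈ Finset.range k, w.1 j < S} ∩ ({w | i < w.1 k} ∩ Bad k i) := by
      ext w; simp
    rw [this]
    refine MeasurableSet.iUnion fun k => MeasurableSet.iUnion fun i => ?_
    have hτ : ∀ j, Measurable fun w : Inputs Ξ Seed => w.1 j := fun j => by fun_prop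
    exact (measurableSet_lt (Finset.measurable_sum _ fun j _ => hτ j) measurable_const).inter
      ((measurableSet_lt measurable_const (hτ k)).inter (hBad k i))
  change ((Measure.infinitePi fun _ : ℕ => ν.toMeasure).prod (sampleLaw D Q)) _ ≤ _
  rw [Measure.prod_apply hm]
  have hle : ∀ᵐ τ ∂(Measure.infinitePi fun _ : ℕ => ν.toMeasure),
      sampleLaw D Q (Prod.mk τ ⁻¹' {w : Inputs Ξ Seed |
        ∃ k i, ∑ j ∈ Finset.range k, w.1 j < S ∧ i < w.1 k ∧ w ∈ Bad k i}) ≤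
        (S + τplus : ℕ) * p := by
    -- With the lengths frozen, the set of iterations is deterministic with at most `S + τplus`
    -- elements, so a plain union bound applies.
    filter_upwards [ae_forall_mem_Icc hν] with τ hτ
    calc _ ≤ sampleLaw D Q (⋃ k ∈ Finset.range (epochCount S τ), ⋃ i ∈ Finset.range (τ k),
          {r | ((τ, r) : Inputs Ξ Seed) ∈ Bad k i}) := by
          refine measure_mono ?_
          rintro r ⟨k, i, hk, hi, hb⟩
          simp only [Set.mem_iUnion, Finset.mem_range]
          exact ⟨k, lt_epochCount_of_sum_lt (fun k => (hτ k).1) hk, i, hi, hb⟩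
      _ ≤ ∑ k ∈ Finset.range (epochCount S τ), ∑ i ∈ Finset.range (τ k),
          sampleLaw D Q {r | ((τ, r) : Inputs Ξ Seed) ∈ Bad k i} :=
        (measure_biUnion_finset_le _ _).trans
          (Finset.sum_le_sum fun k _ => measure_biUnion_finset_le _ _)
      _ ≤ ∑ k ∈ Finset.range (epochCount S τ), ∑ i ∈ Finset.range (τ k), p :=
        Finset.sum_le_sum fun k _ => Finset.sum_le_sum fun i _ => hp τ k i
      _ = (totalIterations S τ : ENNReal) * p := by
        simp only [Finset.sum_const, Finset.card_range, nsmul_eq_mul, totalIterations]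
        rw [← Finset.sum_mul]
        push_cast
        rfl
      _ ≤ _ := by
        gcongr
        exact totalIterations_le fun k => (hτ k).2
  exact (lintegral_mono_ae hle).trans (by simp)

variable {f : Vec m → ℝ} {h : Vec n → EReal} {G : Ξ → Vec n → Vec m} {M : ℝ}
  {solver : Solver n Seed} {ebar dbar : ℝ} {N : BatchSizes} {xinit : Vec n}

/-- The epoch's starting point and the current iterate. -/
noncomputable def anchorPair (f : Vec m → ℝ) (h : Vec n → EReal) (G : Ξ → Vec n → Vec m)
    (M : ℝ) (solver : Solver n Seed) (ebar dbar : ℝ) (N : BatchSizes) (xinit : Vec n)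
    (w : Inputs Ξ Seed) (k i : ℕ) : Vec n × Vec n :=
  (epochStart f h G M solver ebar dbar N xinit w k, iterate f h G M solver ebar dbar N xinit w k i)

omit [IsProbabilityMeasure D] [IsProbabilityMeasure Q] in
theorem measurable_anchorPair (hO : OracleRegularity D G)
    (hsol : SolverAssumption f h M Q solver) (he : 0 < ebar) (hd : 0 < dbar) (k i : ℕ) :
    Measurable fun w : Inputs Ξ Seed => anchorPair f h G M solver ebar dbar N xinit w k i :=
  (measurable_epochStart hO hsol he hd k).prodMk (measurable_iterate hO hsol he hd k i)

omit [MeasurableSpace Ξ] [MeasurableSpace Seed] in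
theorem anchorPair_congr {w w' : Inputs Ξ Seed} (hτ : w.1 = w'.1) (k i : ℕ)
    (hw : ∀ k' i', (k', i') ≠ (k, i) → AgreeAt w w' k' i') :
    anchorPair f h G M solver ebar dbar N xinit w k i =
      anchorPair f h G M solver ebar dbar N xinit w' k i := by
  refine Prod.ext (epochStart_congr hτ k fun k' hk' i' => hw k' i' (by simp [hk'.ne]))
    (iterate_congr hτ k i fun k' i' hlt => hw k' i' ?_)
  rcases hlt with hlt | ⟨-, hlt⟩ <;> simp [hlt.ne]

/-- By causality the anchor pair does not depend on the value samples of the batch `(k, i)`.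
Freezing the Jacobian samples and seeds reduces the claim to `measure_fresh_le` and the bound at
fixed points. -/
theorem sampleLaw_badValue_le (hO : OracleRegularity D G)
    (hsol : SolverAssumption f h M Q solver) (he : 0 < ebar) (hd : 0 < dbar)
    {c : Vec n → Vec m} (hc : Measurable c) {t₀ t₁ : ℝ} (k i : ℕ) {p : ENNReal}
    (hp : ∀ q, (Measure.infinitePi fun _ : ℕ × ℕ × ℕ => D)
      (badBatch G c N.A N.a t₀ t₁ k i q) ≤ p) :
    MeasurableSet {w : Inputs Ξ Seed | w.2.1 ∈ badBatch G c N.A N.a t₀ t₁ k i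
      (anchorPair f h G M solver ebar dbar N xinit w k i)} ∧
    ∀ τ, sampleLaw D Q {r | ((τ, r) : Inputs Ξ Seed) ∈ {w : Inputs Ξ Seed |
      w.2.1 ∈ badBatch G c N.A N.a t₀ t₁ k i
        (anchorPair f h G M solver ebar dbar N xinit w k i)}} ≤ p := by
  have hF := measurable_anchorPair (N := N) (xinit := xinit) hO hsol he hd k i
  have hT := measurableSet_badBatch hO.measurable_value hc N.A N.a t₀ t₁ k i
  have hmeas : MeasurableSet {w : Inputs Ξ Seed | w.2.1 ∈ badBatch G c N.A N.a t₀ t₁ k i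
      (anchorPair f h G M solver ebar dbar N xinit w k i)} :=
    (hF.prodMk (g := fun w : Inputs Ξ Seed => w.2.1) (by fun_prop)) hT
  refine ⟨hmeas, fun τ => ?_⟩
  refine prod_le_of_forall_section_le' _ _ (measurable_prodMk_left hmeas) fun y => ?_
  refine measure_fresh_le D {a : ℕ × ℕ × ℕ | a.1 = k ∧ a.2.1 = i}
    (F := fun ω => anchorPair f h G M solver ebar dbar N xinit ((τ, ω, y) : Inputs Ξ Seed) k i)
    (T := badBatch G c N.A N.a t₀ t₁ k i)
    (hF.comp (g := fun w : Inputs Ξ Seed => anchorPair f h G M solver ebar dbar N xinit w k i)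
      (by fun_prop)) (fun ω ω' hω => ?_) hT (fun q ω ω' hω => ?_) hp
  · exact anchorPair_congr (w := ((τ, ω, y) : Inputs Ξ Seed)) (w' := (τ, ω', y)) rfl k i
      fun k' i' hne => ⟨fun r => hω _ fun hr => hne (Prod.ext hr.1 hr.2), fun _ => rfl, rfl⟩
  · exact mem_badBatch_congr q fun r => hω _ ⟨rfl, rfl⟩

theorem sampleLaw_badJacobian_le (hO : OracleRegularity D G)
    (hsol : SolverAssumption f h M Q solver) (he : 0 < ebar) (hd : 0 < dbar)
    {c : Vec n → Vec n →L[ℝ] Vec m} (hc : Measurable c) {t₀ t₁ : ℝ} (k i : ℕ) {p : ENNReal}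
    (hp : ∀ q, (Measure.infinitePi fun _ : ℕ × ℕ × ℕ => D)
      (badBatch (fun ξ => fderiv ℝ (G ξ)) c N.B N.b t₀ t₁ k i q) ≤ p) :
    MeasurableSet {w : Inputs Ξ Seed |
      w.2.2.1 ∈ badBatch (fun ξ => fderiv ℝ (G ξ)) c N.B N.b t₀ t₁ k i
        (anchorPair f h G M solver ebar dbar N xinit w k i)} ∧
    ∀ τ, sampleLaw D Q {r | ((τ, r) : Inputs Ξ Seed) ∈ {w : Inputs Ξ Seed |
      w.2.2.1 ∈ badBatch (fun ξ => fderiv ℝ (G ξ)) c N.B N.b t₀ t₁ k i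
        (anchorPair f h G M solver ebar dbar N xinit w k i)}} ≤ p := by
  have hF := measurable_anchorPair (N := N) (xinit := xinit) hO hsol he hd k i
  have hT := measurableSet_badBatch (H := fun ξ => fderiv ℝ (G ξ)) hO.measurable_jacobian hc
    N.B N.b t₀ t₁ k i
  have hmeas : MeasurableSet {w : Inputs Ξ Seed |
      w.2.2.1 ∈ badBatch (fun ξ => fderiv ℝ (G ξ)) c N.B N.b t₀ t₁ k i
        (anchorPair f h G M solver ebar dbar N xinit w k i)} :=
    (hF.prodMk (g := fun w : Inputs Ξ Seed => w.2.2.1) (by fun_prop)) hT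
  refine ⟨hmeas, fun τ => ?_⟩
  refine prod_le_of_forall_section_le _ _ (measurable_prodMk_left hmeas) fun z => ?_
  refine prod_le_of_forall_section_le' _ _
    (measurable_prodMk_left (measurable_prodMk_left hmeas)) fun y => ?_
  refine measure_fresh_le D {a : ℕ × ℕ × ℕ | a.1 = k ∧ a.2.1 = i}
    (F := fun ω => anchorPair f h G M solver ebar dbar N xinit ((τ, z, ω, y) : Inputs Ξ Seed) k i)
    (T := badBatch (fun ξ => fderiv ℝ (G ξ)) c N.B N.b t₀ t₁ k i)
    (hF.comp (g := fun w : Inputs Ξ Seed => anchorPair f h G M solver ebar dbar N xinit w k i)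
      (by fun_prop)) (fun ω ω' hω => ?_) hT (fun q ω ω' hω => ?_) hp
  · exact anchorPair_congr (w := ((τ, z, ω, y) : Inputs Ξ Seed)) (w' := (τ, z, ω', y)) rfl k i
      fun k' i' hne => ⟨fun _ => rfl, fun r => hω _ fun hr => hne (Prod.ext hr.1 hr.2), rfl⟩
  · exact mem_badBatch_congr q fun r => hω _ ⟨rfl, rfl⟩

/-- Same argument with all samples frozen and a single fresh coordinate, the seed `(k, i)`. -/
theorem sampleLaw_badSeeds_le (hO : OracleRegularity D G) (hf : Continuous f)
    (hh : ClosedConvexProper h)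
    (hsol : SolverAssumption f h M Q solver) (he : 0 < ebar) (hd : 0 < dbar) (k i : ℕ) :
    MeasurableSet {w : Inputs Ξ Seed | w.2.2.2 (k, i) ∈ badSeeds f h M solver ebar dbar
      (subproblemData f h G M solver ebar dbar N xinit w k i)} ∧
    ∀ τ, sampleLaw D Q {r | ((τ, r) : Inputs Ξ Seed) ∈ {w : Inputs Ξ Seed |
      w.2.2.2 (k, i) ∈ badSeeds f h M solver ebar dbar
        (subproblemData f h G M solver ebar dbar N xinit w k i)}} ≤ ENNReal.ofReal dbar := by
  have hF := measurable_subproblemData (N := N) (xinit := xinit) hO hsol he hd k i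
  have hT := measurableSet_badSeeds hf hh hsol he hd
  have hmeas : MeasurableSet {w : Inputs Ξ Seed | w.2.2.2 (k, i) ∈
      badSeeds f h M solver ebar dbar
        (subproblemData f h G M solver ebar dbar N xinit w k i)} :=
    (hF.prodMk (g := fun w : Inputs Ξ Seed => w.2.2.2 (k, i)) (by fun_prop)) hT
  refine ⟨hmeas, fun τ => ?_⟩
  refine prod_le_of_forall_section_le _ _ (measurable_prodMk_left hmeas) fun z => ?_
  refine prod_le_of_forall_section_le _ _
    (measurable_prodMk_left (measurable_prodMk_left hmeas)) fun z' => ?_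
  refine measure_fresh_le Q {(k, i)}
    (F := fun ω => subproblemData f h G M solver ebar dbar N xinit
      ((τ, z, z', ω) : Inputs Ξ Seed) k i)
    (T := fun q => {ω | ω (k, i) ∈ badSeeds f h M solver ebar dbar q})
    (hF.comp (g := fun w : Inputs Ξ Seed => subproblemData f h G M solver ebar dbar N xinit w k i)
      (by fun_prop)) (fun ω ω' hω => ?_) ?_ (fun q ω ω' hω => ?_) fun q => ?_
  · exact subproblemData_congr (w := ((τ, z, z', ω) : Inputs Ξ Seed)) (w' := (τ, z, z', ω'))
      rfl rfl rfl k i fun q hq => hω q hq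
  · exact Measurable.prodMk (f := fun q : (Vec n × Vec m × (Vec n →L[ℝ] Vec m)) ×
      (ℕ × ℕ → Seed) => q.1) (g := fun q => q.2 (k, i)) (by fun_prop) (by fun_prop) hT
  · simp only [Set.mem_ofPred_eq, hω (k, i) rfl]
  · have hq : MeasurableSet (badSeeds f h M solver ebar dbar q) :=
      measurable_prodMk_left (x := q) hT
    have := (measurePreserving_eval_infinitePi (fun _ : ℕ × ℕ => Q) (k, i)).measure_preimage
      hq.nullMeasurableSet
    exact (this.trans_le (measure_badSeeds_le hf hh hsol he hd q))

end BadEvents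


/-! ### The average squared gradient along a good run -/

section Deterministic

/-- Cauchy–Schwarz on the telescoped path gives one factor `T`; summing over `i` gives the other. -/
theorem sum_sq_dist_le {n : ℕ} (x : ℕ → Vec n) (T : ℕ) :
    ∑ i ∈ Finset.range T, ‖x i - x 0‖ ^ 2 ≤
      (T : ℝ) ^ 2 * ∑ i ∈ Finset.range T, ‖x (i + 1) - x i‖ ^ 2 := by
  have h1 : ∀ i ∈ Finset.range T,
      ‖x i - x 0‖ ^ 2 ≤ T * ∑ j ∈ Finset.range T, ‖x (j + 1) - x j‖ ^ 2 := by
    intro i hi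
    have hi' : i ≤ T := (Finset.mem_range.1 hi).le
    have h2 : ‖x i - x 0‖ ≤ ∑ j ∈ Finset.range i, ‖x (j + 1) - x j‖ := by
      rw [← Finset.sum_range_sub]
      exact norm_sum_le _ _
    calc ‖x i - x 0‖ ^ 2 ≤ (∑ j ∈ Finset.range i, ‖x (j + 1) - x j‖) ^ 2 :=
          pow_le_pow_left₀ (norm_nonneg _) h2 2
      _ ≤ (Finset.range i).card * ∑ j ∈ Finset.range i, ‖x (j + 1) - x j‖ ^ 2 :=
          sq_sum_le_card_mul_sum_sq
      _ ≤ T * ∑ j ∈ Finset.range T, ‖x (j + 1) - x j‖ ^ 2 := by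
          refine mul_le_mul (by rw [Finset.card_range]; exact_mod_cast hi')
            (Finset.sum_le_sum_of_subset_of_nonneg (Finset.range_mono hi')
              fun _ _ _ => sq_nonneg _) (Finset.sum_nonneg fun _ _ => sq_nonneg _)
            (Nat.cast_nonneg _)
  refine (Finset.sum_le_card_nsmul _ _ _ h1).trans_eq ?_
  rw [Finset.card_range, nsmul_eq_mul]
  ring

/-- The drift terms sum to at most `β` times the sum of the squared steps, because `T ≤ τplus`. As
`β ≤ a`, the descent terms absorb them, and only `T * e` remains. -/
theorem epoch_descent {n : ℕ} (x : ℕ → Vec n) (φ p : ℕ → ℝ) {T τplus : ℕ} (hT : T ≤ τplus)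
    (hτ : 1 ≤ τplus) {a b e β : ℝ} (hβ : 0 ≤ β) (hβa : β ≤ a)
    (hstep : ∀ i < T, φ (i + 1) + a * ‖x (i + 1) - x i‖ ^ 2 + b * p i ≤
      φ i + e + β * (‖x i - x 0‖ ^ 2 / (τplus : ℝ) ^ 2)) :
    φ T + b * ∑ i ∈ Finset.range T, p i ≤ φ 0 + T * e := by
  have h1 := Finset.sum_le_sum fun i hi => hstep i (Finset.mem_range.1 hi)
  simp only [Finset.sum_add_distrib, ← Finset.mul_sum, ← Finset.sum_div, Finset.sum_const,
    Finset.card_range, nsmul_eq_mul] at h1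
  have h2 := Finset.sum_range_sub φ T
  rw [Finset.sum_sub_distrib] at h2
  have hτ0 : (0 : ℝ) < τplus := by exact_mod_cast hτ
  set s := ∑ i ∈ Finset.range T, ‖x (i + 1) - x i‖ ^ 2 with hs
  have hs0 : 0 ≤ s := Finset.sum_nonneg fun _ _ => sq_nonneg _
  have h3 : (∑ i ∈ Finset.range T, ‖x i - x 0‖ ^ 2) / (τplus : ℝ) ^ 2 ≤ s := by
    rw [div_le_iff₀ (by positivity), mul_comm]
    refine (sum_sq_dist_le x T).trans (mul_le_mul_of_nonneg_right ?_ hs0)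
    exact pow_le_pow_left₀ (Nat.cast_nonneg _) (by exact_mod_cast hT) 2
  have h4 := mul_le_mul_of_nonneg_left h3 hβ
  have h5 := mul_le_mul_of_nonneg_right hβa hs0
  linarith

/-- With `u = √ε` and `z = d/τ`, the value error contains the product `κuz ≤ κ(u² + z²)`, and
squaring the Jacobian error gives at most `2λ²(u² + z²)`. This is why value thresholds are of order
`ε` and `√ε/τ`, but Jacobian thresholds only `√ε` and `1/τ`. -/
theorem estimate_errors_le {l_f M κ ε ev eJ d τ lam : ℝ} (hl : 0 ≤ l_f) (hM : 0 < M) (hκ : 0 ≤ κ)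
    (hε : 0 ≤ ε) (hev : ev ≤ κ * ε + κ * √ε / τ * d)
    (heJ0 : 0 ≤ eJ) (heJ : eJ ≤ lam * √ε + lam / τ * d) :
    5 * l_f * ev + 100 * l_f ^ 2 / M * eJ ^ 2 ≤
      (10 * l_f * κ + 200 * l_f ^ 2 * lam ^ 2 / M) * ε +
        (10 * l_f * κ + 200 * l_f ^ 2 * lam ^ 2 / M) * (d ^ 2 / τ ^ 2) := by
  have hsq : √ε ^ 2 = ε := Real.sq_sqrt hε
  set u := √ε
  set z := d / τ with hz
  have h1 : κ * u / τ * d = κ * (u * z) := by rw [hz]; ring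
  have h2 : lam / τ * d = lam * z := by rw [hz]; ring
  have h3 : d ^ 2 / τ ^ 2 = z ^ 2 := by rw [hz, div_pow]
  rw [h1, ← hsq] at hev
  rw [h2] at heJ
  rw [h3, ← hsq]
  have h4 : u * z ≤ u ^ 2 + z ^ 2 := by nlinarith [sq_nonneg (u - z), sq_nonneg u, sq_nonneg z]
  have h5 : ev ≤ 2 * κ * u ^ 2 + 2 * κ * z ^ 2 := by
    have h6 := mul_le_mul_of_nonneg_left h4 hκ
    have h7 : 0 ≤ κ * z ^ 2 := by positivity
    linarith
  have h6 : eJ ^ 2 ≤ 2 * lam ^ 2 * u ^ 2 + 2 * lam ^ 2 * z ^ 2 := by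
    have h8 := pow_le_pow_left₀ heJ0 heJ 2
    nlinarith [sq_nonneg (lam * u - lam * z)]
  have h7 := mul_le_mul_of_nonneg_left h5 (show (0 : ℝ) ≤ 5 * l_f by positivity)
  have h8 := mul_le_mul_of_nonneg_left h6 (show (0 : ℝ) ≤ 100 * l_f ^ 2 / M by positivity)
  refine (add_le_add h7 h8).trans (le_of_eq ?_)
  ring

variable {m n : ℕ} {Ξ Seed : Type*} [MeasurableSpace Ξ] {D : Measure Ξ} {f : Vec m → ℝ}
  {h : Vec n → EReal} {G : Ξ → Vec n → Vec m} {M : ℝ}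
  {solver : Solver n Seed} {ebar dbar : ℝ} {N : BatchSizes} {xinit : Vec n}

/-- At the iteration `(k, i)` neither the batches nor the solver are bad. -/
structure GoodAt (D : Measure Ξ) (f : Vec m → ℝ) (h : Vec n → EReal) (G : Ξ → Vec n → Vec m)
    (M : ℝ) (solver : Solver n Seed) (ebar dbar : ℝ) (N : BatchSizes) (xinit : Vec n)
    (s₀ s₁ t₀ t₁ : ℝ) (w : Inputs Ξ Seed) (k i : ℕ) : Prop where
  value : w.2.1 ∉ badBatch G (innerMap D G) N.A N.a s₀ s₁ k i
    (anchorPair f h G M solver ebar dbar N xinit w k i)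
  jacobian : w.2.2.1 ∉ badBatch (fun ξ => fderiv ℝ (G ξ)) (fderiv ℝ (innerMap D G)) N.B N.b t₀ t₁
    k i (anchorPair f h G M solver ebar dbar N xinit w k i)
  seed : w.2.2.2 (k, i) ∉ badSeeds f h M solver ebar dbar
    (subproblemData f h G M solver ebar dbar N xinit w k i)

/-- The objective, as a real number where it is finite. -/
noncomputable def realObjective (f : Vec m → ℝ) (g : Vec n → Vec m) (h : Vec n → EReal)
    (x : Vec n) : ℝ := f (g x) + (h x).toReal

/-- Finiteness of `h` is carried along with the descent, so that the real-valued objective can be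
telescoped. -/
theorem good_step {l_f l_g L_g Φ₀ ε κ lam β : ℝ} {w : Inputs Ξ Seed} {τplus : ℕ}
    (hs : StandingAssumptions f (innerMap D G) h l_f l_g L_g)
    (hl : 0 ≤ l_f) (hL : 0 ≤ L_g) (hM : 5 * l_f * L_g < M)
    (hΦ : ∀ x, (Φ₀ : EReal) ≤ objective f (innerMap D G) h x) (hε : 0 ≤ ε) (hκ : 0 ≤ κ)
    (hβ : β = 10 * l_f * κ + 200 * l_f ^ 2 * lam ^ 2 / M) {k i : ℕ}
    (h₀ : GoodAt D f h G M solver ebar dbar N xinit (κ * ε) (κ * √ε / τplus) (lam * √ε)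
      (lam / τplus) w k 0)
    (hi : GoodAt D f h G M solver ebar dbar N xinit (κ * ε) (κ * √ε / τplus) (lam * √ε)
      (lam / τplus) w k i)
    (hfin : h (iterate f h G M solver ebar dbar N xinit w k i) ≠ ⊤) :
    h (iterate f h G M solver ebar dbar N xinit w k (i + 1)) ≠ ⊤ ∧
    realObjective f (innerMap D G) h (iterate f h G M solver ebar dbar N xinit w k (i + 1)) +
      M / 5 * ‖iterate f h G M solver ebar dbar N xinit w k (i + 1) -
        iterate f h G M solver ebar dbar N xinit w k i‖ ^ 2 +
      M / 10 * ‖iterate f h G M solver ebar dbar N xinit w k i -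
        proxLinearPoint f (innerMap D G) h M
          (iterate f h G M solver ebar dbar N xinit w k i)‖ ^ 2 ≤
    realObjective f (innerMap D G) h (iterate f h G M solver ebar dbar N xinit w k i) +
      (16 / 5 * ebar + β * ε) +
      β * (‖iterate f h G M solver ebar dbar N xinit w k i -
        iterate f h G M solver ebar dbar N xinit w k 0‖ ^ 2 / (τplus : ℝ) ^ 2) := by
  have hM0 : 0 < M := by nlinarith [mul_nonneg hl hL]
  obtain ⟨a, ha⟩ := hs.h_closed_convex_proper.eq_coe hfin
  have hseed := hi.seed
  simp only [badSeeds, Set.mem_ofPred_eq, not_not] at hseed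
  rw [← iterate_succ (f := f) (h := h) (G := G) (M := M) (solver := solver) (ebar := ebar)
    (dbar := dbar) (N := N) (xinit := xinit) w k i] at hseed
  obtain ⟨b, hb, hdesc⟩ := descent_step hs hl hL hM hΦ _ _ ha hseed
  have hx0 : epochStart f h G M solver ebar dbar N xinit w k =
      iterate f h G M solver ebar dbar N xinit w k 0 := rfl
  have hzero : i = 0 → iterate f h G M solver ebar dbar N xinit w k i =
      epochStart f h G M solver ebar dbar N xinit w k := fun h0 => by rw [h0]; rfl
  have hev := vrEstimate_error_le hzero h₀.value hi.value
  have heJ := vrEstimate_error_le hzero h₀.jacobian hi.jacobian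
  have herr := estimate_errors_le hl hM0 hκ hε hev (norm_nonneg _) heJ
  rw [← hβ, hx0] at herr
  simp only [subproblemData, hx0] at hdesc
  refine ⟨by rw [hb]; exact EReal.coe_ne_top b, ?_⟩
  unfold realObjective
  rw [hb, ha, EReal.toReal_coe, EReal.toReal_coe]
  linarith

/-- Along a good run the average squared norm of the generalized gradient is small. -/
theorem averageSqGradient_le {l_f l_g L_g Γ ε κ lam β : ℝ} {w : Inputs Ξ Seed} {τplus S : ℕ}
    (hs : StandingAssumptions f (innerMap D G) h l_f l_g L_g)
    (hl : 0 ≤ l_f) (hL : 0 ≤ L_g) (hM : 5 * l_f * L_g < M)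
    (hbot : ⊥ < ⨅ x, objective f (innerMap D G) h x)
    (hinit : objective f (innerMap D G) h xinit ≤
      (⨅ x, objective f (innerMap D G) h x) + (Γ : EReal))
    (hΓ : 0 ≤ Γ) (hε : 0 ≤ ε) (hκ : 0 ≤ κ)
    (hβ : β = 10 * l_f * κ + 200 * l_f ^ 2 * lam ^ 2 / M) (hβM : β ≤ M / 5) (hS : 1 ≤ S)
    (hτ : ∀ k, 1 ≤ w.1 k ∧ w.1 k ≤ τplus)
    (hgood : ∀ k i, ∑ j ∈ Finset.range k, w.1 j < S → i < w.1 k →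
      GoodAt D f h G M solver ebar dbar N xinit (κ * ε) (κ * √ε / τplus) (lam * √ε)
        (lam / τplus) w k i) :
    averageSqGradient D f h G M solver ebar dbar N xinit S w ≤
      10 * M * (Γ / S + 16 / 5 * ebar + β * ε) := by
  have hM0 : 0 < M := by nlinarith [mul_nonneg hl hL]
  have hτ1 : 1 ≤ τplus := (hτ 0).1.trans (hτ 0).2
  have hβ0 : 0 ≤ β := by rw [hβ]; positivity
  obtain ⟨y₀, hy₀⟩ := hs.h_closed_convex_proper.exists_ne_top
  obtain ⟨a₀, ha₀⟩ := hs.h_closed_convex_proper.eq_coe hy₀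
  obtain ⟨Φ₀, hΦ₀⟩ : ∃ Φ₀ : ℝ, (⨅ x, objective f (innerMap D G) h x) = Φ₀ := by
    refine ⟨(⨅ x, objective f (innerMap D G) h x).toReal, (EReal.coe_toReal ?_ hbot.ne').symm⟩
    refine ne_top_of_le_ne_top ?_ (iInf_le _ y₀)
    rw [objective, ha₀, ← EReal.coe_add]
    exact EReal.coe_ne_top _
  have hΦ : ∀ x, (Φ₀ : EReal) ≤ objective f (innerMap D G) h x := fun x => hΦ₀ ▸ iInf_le _ x
  rw [hΦ₀, ← EReal.coe_add] at hinit
  have hfin0 : h xinit ≠ ⊤ := by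
    intro htop
    rw [objective, htop, EReal.coe_add_top] at hinit
    exact absurd hinit (not_le.2 (EReal.coe_lt_top _))
  have hreal : ∀ x, h x ≠ ⊤ →
      objective f (innerMap D G) h x = (realObjective f (innerMap D G) h x : EReal) := by
    intro x hx
    rw [objective, realObjective, EReal.coe_add,
      EReal.coe_toReal hx (hs.h_closed_convex_proper.ne_bot x)]
  rw [hreal _ hfin0, EReal.coe_le_coe_iff] at hinit
  set x := iterate f h G M solver ebar dbar N xinit w with hx
  set K := epochCount S w.1 with hK
  set e := 16 / 5 * ebar + β * ε with he
  set P : ℕ → ℕ → ℝ := fun k i => ‖x k i - proxLinearPoint f (innerMap D G) h M (x k i)‖ ^ 2 with hP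
  have hepoch : ∀ k < K, h (x k 0) ≠ ⊤ → h (x (k + 1) 0) ≠ ⊤ ∧
      realObjective f (innerMap D G) h (x (k + 1) 0) +
        M / 10 * ∑ i ∈ Finset.range (w.1 k), P k i ≤
      realObjective f (innerMap D G) h (x k 0) + w.1 k * e := by
    intro k hk hk0
    have hkS := sum_lt_of_lt_epochCount hk
    have h₀ := hgood k 0 hkS (hτ k).1
    have hfin : ∀ i ≤ w.1 k, h (x k i) ≠ ⊤ := by
      intro i
      induction i with
      | zero => exact fun _ => hk0
      | succ i ih =>
        intro hi
        exact (good_step hs hl hL hM hΦ hε hκ hβ h₀ (hgood k i hkS hi) (ih (by omega))).1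
    have hlast : x (k + 1) 0 = x k (w.1 k) := rfl
    rw [hlast]
    refine ⟨hfin _ le_rfl, ?_⟩
    exact epoch_descent (x k) (fun i => realObjective f (innerMap D G) h (x k i)) (P k)
      (hτ k).2 hτ1 hβ0 hβM fun i hi =>
        (good_step hs hl hL hM hΦ hε hκ hβ h₀ (hgood k i hkS hi) (hfin i hi.le)).2
  have hrun : ∀ k ≤ K, h (x k 0) ≠ ⊤ ∧ realObjective f (innerMap D G) h (x k 0) +
      M / 10 * ∑ k' ∈ Finset.range k, ∑ i ∈ Finset.range (w.1 k'), P k' i ≤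
      realObjective f (innerMap D G) h xinit + (∑ k' ∈ Finset.range k, (w.1 k' : ℝ)) * e := by
    intro k
    induction k with
    | zero =>
      intro _
      refine ⟨hfin0, ?_⟩
      simp only [Finset.range_zero, Finset.sum_empty, mul_zero, zero_mul, add_zero]
      exact le_rfl
    | succ k ih =>
      intro hk
      obtain ⟨h1, h2⟩ := ih (by omega)
      obtain ⟨h3, h4⟩ := hepoch k (by omega) h1
      refine ⟨h3, ?_⟩
      rw [Finset.sum_range_succ, Finset.sum_range_succ, add_mul]
      linarith
  obtain ⟨hK1, hK2⟩ := hrun K le_rfl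
  have hlow := hΦ (x K 0)
  rw [hreal _ hK1, EReal.coe_le_coe_iff] at hlow
  have htot : (∑ k' ∈ Finset.range K, (w.1 k' : ℝ)) = totalIterations S w.1 := by
    simp [totalIterations, hK]
  rw [htot] at hK2
  have hSle : (S : ℝ) ≤ totalIterations S w.1 := by
    exact_mod_cast le_totalIterations fun k => (hτ k).1
  have hSpos : (0 : ℝ) < S := by exact_mod_cast hS
  set total : ℝ := ((totalIterations S w.1 : ℕ) : ℝ)
  have htotal : 0 < total := hSpos.trans_le hSle
  have hsum : ∑ k ∈ Finset.range K, ∑ i ∈ Finset.range (w.1 k),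
      ‖generalizedGradient f (innerMap D G) h M (x k i)‖ ^ 2 =
      M ^ 2 * ∑ k ∈ Finset.range K, ∑ i ∈ Finset.range (w.1 k), P k i := by
    simp only [Finset.mul_sum]
    refine Finset.sum_congr rfl fun k _ => Finset.sum_congr rfl fun i _ => ?_
    rw [generalizedGradient, norm_smul, mul_pow, Real.norm_eq_abs, sq_abs]
  change 1 / total * ∑ k ∈ Finset.range K, ∑ i ∈ Finset.range (w.1 k),
      ‖generalizedGradient f (innerMap D G) h M (x k i)‖ ^ 2 ≤ _
  rw [hsum]
  set T := ∑ k ∈ Finset.range K, ∑ i ∈ Finset.range (w.1 k), P k i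
  have hT : M / 10 * T ≤ Γ + total * e := by linarith
  have h1 : 1 / total * (M ^ 2 * T) = 10 * M * ((M / 10 * T) / total) := by field_simp
  rw [h1, add_assoc, ← he]
  refine mul_le_mul_of_nonneg_left ?_ (by positivity)
  calc M / 10 * T / total ≤ (Γ + total * e) / total := div_le_div_of_nonneg_right hT htotal.le
    _ = Γ / total + e := by field_simp
    _ ≤ Γ / S + e := by
      have := div_le_div_of_nonneg_left hΓ hSpos hSle
      linarith

end Deterministic


/-! ### Probability of a good run -/

section GoodRun

variable {m n : ℕ} {Ξ Seed : Type*} [MeasurableSpace Ξ] [MeasurableSpace Seed]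
  {D : Measure Ξ} [IsProbabilityMeasure D] {Q : Measure Seed} [IsProbabilityMeasure Q]
  {f : Vec m → ℝ} {h : Vec n → EReal} {G : Ξ → Vec n → Vec m} {M : ℝ}
  {solver : Solver n Seed} {ebar dbar : ℝ} {N : BatchSizes} {xinit : Vec n}

theorem inputLaw_not_good_le {l_f l_g L_g : ℝ} (hO : OracleRegularity D G)
    (hs : StandingAssumptions f (innerMap D G) h l_f l_g L_g)
    (hsol : SolverAssumption f h M Q solver) (he : 0 < ebar) (hd : 0 < dbar)
    {ν : PMF ℕ} {τplus S : ℕ} (hν : ν.support ⊆ Set.Icc 1 τplus) {s₀ s₁ t₀ t₁ p : ℝ} (hp : 0 ≤ p)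
    (hA : ∀ k i q, (Measure.infinitePi fun _ : ℕ × ℕ × ℕ => D)
      (badBatch G (innerMap D G) N.A N.a s₀ s₁ k i q) ≤ ENNReal.ofReal p)
    (hB : ∀ k i q, (Measure.infinitePi fun _ : ℕ × ℕ × ℕ => D)
      (badBatch (fun ξ => fderiv ℝ (G ξ)) (fderiv ℝ (innerMap D G)) N.B N.b t₀ t₁ k i q) ≤
        ENNReal.ofReal p) :
    (inputLaw ν D Q).real {w | ¬ ∀ k i, ∑ j ∈ Finset.range k, w.1 j < S → i < w.1 k →
      GoodAt D f h G M solver ebar dbar N xinit s₀ s₁ t₀ t₁ w k i} ≤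
      ((S : ℝ) + τplus) * (p + p + dbar) := by
  have hg : Measurable (innerMap D G) := hs.g_differentiable.continuous.measurable
  have hg' : Measurable (fderiv ℝ (innerMap D G)) := measurable_fderiv ℝ _
  have h1 := fun k i => sampleLaw_badValue_le (N := N) (xinit := xinit) (Q := Q) hO hsol he hd hg
    k i (hA k i)
  have h2 := fun k i => sampleLaw_badJacobian_le (N := N) (xinit := xinit) (Q := Q) hO hsol he hd
    hg' k i (hB k i)
  have h3 := fun k i => sampleLaw_badSeeds_le (D := D) (N := N) (xinit := xinit) hO
    (continuous_of_abs_sub_le hs.f_lipschitz) hs.h_closed_convex_proper hsol he hd k i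
  have key := inputLaw_exists_bad_le (D := D) (Q := Q) hν S
    (fun k i => ((h1 k i).1.union (h2 k i).1).union (h3 k i).1)
    (p := ENNReal.ofReal (p + p + dbar)) fun τ k i => by
      rw [ENNReal.ofReal_add (by positivity) hd.le, ENNReal.ofReal_add hp hp]
      refine (measure_union_le _ _).trans (add_le_add ((measure_union_le _ _).trans
        (add_le_add ((h1 k i).2 τ) ((h2 k i).2 τ))) ((h3 k i).2 τ))
  refine ENNReal.toReal_le_of_le_ofReal (by positivity) ?_
  rw [ENNReal.ofReal_mul (by positivity), ← Nat.cast_add, ENNReal.ofReal_natCast]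
  refine le_trans (measure_mono ?_) key
  intro w hw
  simp only [Set.mem_ofPred_eq, not_forall] at hw
  obtain ⟨k, i, hk, hi, hbad⟩ := hw
  refine ⟨k, i, hk, hi, ?_⟩
  by_contra hno
  refine hbad ⟨fun hb => hno (Or.inl (Or.inl hb)), fun hb => hno (Or.inl (Or.inr hb)),
    fun hb => hno (Or.inr hb)⟩

/-- If the good-run event and the epoch-count event are likely, so is their intersection. -/
theorem inputLaw_good_ge {ν : PMF ℕ} {τplus S T : ℕ} (hν : ν.support ⊆ Set.Icc 1 τplus)
    {good goal : Set (Inputs Ξ Seed)} {a b : ℝ} (ha : (inputLaw ν D Q).real goodᶜ ≤ a)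
    (hb : (Measure.infinitePi fun _ : ℕ => ν.toMeasure).real
      {τ | ∑ k ∈ Finset.range T, τ k < S} ≤ b)
    (hgoal : ∀ w ∈ good, (∀ k, 1 ≤ w.1 k ∧ w.1 k ≤ τplus) →
      S ≤ ∑ k ∈ Finset.range T, w.1 k → w ∈ goal) :
    1 - a - b ≤ (inputLaw ν D Q).real goal := by
  have hmp : MeasurePreserving (Prod.fst : Inputs Ξ Seed → (ℕ → ℕ)) (inputLaw ν D Q)
      (Measure.infinitePi fun _ : ℕ => ν.toMeasure) :=
    measurePreserving_fst (μ := Measure.infinitePi fun _ : ℕ => ν.toMeasure)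
      (ν := sampleLaw D Q)
  have : IsProbabilityMeasure (inputLaw ν D Q) := by unfold inputLaw; infer_instance
  have hnull : (inputLaw ν D Q) {w : Inputs Ξ Seed | ¬ ∀ k, 1 ≤ w.1 k ∧ w.1 k ≤ τplus} = 0 :=
    hmp.quasiMeasurePreserving.ae (ae_forall_mem_Icc hν)
  have hm : MeasurableSet {τ : ℕ → ℕ | ∑ k ∈ Finset.range T, τ k < S} :=
    measurableSet_lt (Finset.measurable_sum _ fun k _ => measurable_pi_apply k) measurable_const
  have hb' : (inputLaw ν D Q).real {w : Inputs Ξ Seed | ∑ k ∈ Finset.range T, w.1 k < S} ≤ b := by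
    have := hmp.measure_preimage hm.nullMeasurableSet
    exact (congrArg ENNReal.toReal this).trans_le hb
  -- Subadditivity over a cover needs no measurability of `good` or `goal`.
  have hcover : (Set.univ : Set (Inputs Ξ Seed)) ⊆
      ((goal ∪ goodᶜ) ∪ {w | ∑ k ∈ Finset.range T, w.1 k < S}) ∪
        {w | ¬ ∀ k, 1 ≤ w.1 k ∧ w.1 k ≤ τplus} := by
    intro w _
    by_cases h1 : ∀ k, 1 ≤ w.1 k ∧ w.1 k ≤ τplus
    · by_cases h2 : S ≤ ∑ k ∈ Finset.range T, w.1 k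
      · by_cases h3 : w ∈ good
        · exact Or.inl (Or.inl (Or.inl (hgoal w h3 h1 h2)))
        · exact Or.inl (Or.inl (Or.inr h3))
      · exact Or.inl (Or.inr (not_le.1 h2))
    · exact Or.inr h1
  have h1 := measureReal_mono (μ := inputLaw ν D Q) hcover (measure_ne_top _ _)
  rw [probReal_univ] at h1
  have h2 := measureReal_union_le (μ := inputLaw ν D Q)
    ((goal ∪ goodᶜ) ∪ {w | ∑ k ∈ Finset.range T, w.1 k < S})
    {w | ¬ ∀ k, 1 ≤ w.1 k ∧ w.1 k ≤ τplus}
  have h3 := measureReal_union_le (μ := inputLaw ν D Q) (goal ∪ goodᶜ)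
    {w | ∑ k ∈ Finset.range T, w.1 k < S}
  have h4 := measureReal_union_le (μ := inputLaw ν D Q) goal goodᶜ
  have h5 : (inputLaw ν D Q).real {w : Inputs Ξ Seed | ¬ ∀ k, 1 ≤ w.1 k ∧ w.1 k ≤ τplus} = 0 := by
    rw [measureReal_def, hnull, ENNReal.toReal_zero]
  linarith

end GoodRun

/-! ### Choice of parameters -/

section Parameters

/-- Every rate becomes a natural power of `z = ε^(-1/3)`. -/
theorem cube_root_inv_pow {ε : ℝ} (hε : 0 < ε) (j : ℕ) {r : ℝ} (hr : r = -((j : ℝ) / 3)) :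
    ε ^ r = (ε ^ (-(1 / 3) : ℝ)) ^ j := by
  rw [← Real.rpow_natCast, ← Real.rpow_mul hε.le, hr]
  congr 1
  ring

theorem exists_threshold (Z : ℝ) :
    ∃ ε₀ : ℝ, 0 < ε₀ ∧ ∀ ε, 0 < ε → ε < ε₀ → Z ≤ ε ^ (-(1 / 3) : ℝ) := by
  have hZ : 0 < |Z| + 1 := by positivity
  refine ⟨((|Z| + 1) ^ 3)⁻¹, by positivity, fun ε hε hlt => ?_⟩
  have h1 : (|Z| + 1) ^ 3 ≤ (ε ^ (-(1 / 3) : ℝ)) ^ 3 := by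
    rw [← cube_root_inv_pow hε 3 (r := -1) (by norm_num), Real.rpow_neg_one]
    exact ((lt_inv_comm₀ (by positivity) hε).2 hlt).le
  have h2 := le_of_pow_le_pow_left₀ (by norm_num) (by positivity) h1
  linarith [le_abs_self Z]

/-- One spare power of `z` swallows the constants and dimensions, leaving `log (z⁴/Δ) = 4/3 log(1/ε)
+ log(1/Δ)`. Since `log(1/Δ)` may be small, turning this sum into a product requires `log(1/ε)
log(1/Δ) ≥ 1` and the square of `log(1/ε)`. -/
theorem log_factor_le {ε Δ q Q S c z : ℝ} (hz : z ^ 3 = ε⁻¹) (hz1 : 1 ≤ z)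
    (hΔ : 0 < Δ) (hq : 0 ≤ q) (hqQ : q ≤ Q) (hS : 1 ≤ S) (hSc : S ≤ c * z ^ 3)
    (hQ : 5 * Q * c ≤ z) (h1 : 1 ≤ Real.log (1 / ε))
    (h2 : 1 ≤ Real.log (1 / ε) * Real.log (1 / Δ)) :
    Real.log (5 * q * S / Δ) ≤ 4 * (Real.log (1 / ε) ^ 2 * Real.log (1 / Δ)) := by
  have hz0 : 0 < z := by linarith
  have hlogz : Real.log (1 / ε) = 3 * Real.log z := by
    rw [one_div, ← hz, Real.log_pow]; norm_num
  have hΔ0 : 0 ≤ Real.log (1 / Δ) := by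
    by_contra hneg
    nlinarith
  -- In the degenerate case `q = 0` the convention `log 0 = 0` applies.
  rcases hq.eq_or_lt with rfl | hq0
  · simp only [mul_zero, zero_mul, zero_div, Real.log_zero]
    positivity
  have hle : 5 * q * S ≤ z ^ 4 := by
    have hS0 : 0 ≤ S := by linarith
    calc 5 * q * S ≤ 5 * Q * S := by gcongr
      _ ≤ 5 * Q * (c * z ^ 3) := mul_le_mul_of_nonneg_left hSc (by linarith)
      _ = 5 * Q * c * z ^ 3 := by ring
      _ ≤ z * z ^ 3 := mul_le_mul_of_nonneg_right hQ (by positivity)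
      _ = z ^ 4 := by ring
  have hlog : Real.log (5 * q * S / Δ) ≤ 4 * Real.log z + Real.log (1 / Δ) := by
    rw [div_eq_mul_one_div, Real.log_mul (by positivity) (by positivity)]
    have := Real.log_le_log (by positivity) hle
    rw [Real.log_pow] at this
    push_cast at this
    linarith
  set a := Real.log (1 / ε)
  set b := Real.log (1 / Δ)
  nlinarith [mul_le_mul_of_nonneg_left h2 (by linarith : (0 : ℝ) ≤ a),
    mul_nonneg hΔ0 (by nlinarith : (0 : ℝ) ≤ a ^ 2 - 1)]

/-- The factor `3` yields `exp (-X) ≤ (Δ/(5S))³`. One power of `S` pays for the norming set (`u ≤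
S`), another for the union bound; the third is spare. -/
theorem tail_le {u X q S Δ τ : ℝ} (hq : 1 ≤ q) (hS : 1 ≤ S) (hΔ : 0 < Δ) (hΔ1 : Δ ≤ 1)
    (hu : u ≤ S) (hτ : 0 ≤ τ) (hτS : τ ≤ S) (hX : 3 * Real.log (5 * q * S / Δ) ≤ X) :
    u * Real.exp (-X) ≤ Δ / (4 * (S + τ)) := by
  have hS0 : 0 < S := by linarith
  set y := 5 * q * S / Δ with hy
  have hy0 : 5 * S / Δ ≤ y := by
    rw [hy]
    gcongr
    linarith
  have hypos : 0 < 5 * S / Δ := by positivity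
  have h1 : Real.exp (-X) ≤ (y ^ 3)⁻¹ := by
    rw [← Real.exp_log (show 0 < (y ^ 3)⁻¹ by have := hypos.trans_le hy0; positivity),
      Real.log_inv, Real.log_pow]
    exact Real.exp_le_exp.2 (by push_cast; linarith)
  have h2 : (y ^ 3)⁻¹ ≤ ((5 * S / Δ) ^ 3)⁻¹ := by gcongr
  calc u * Real.exp (-X) ≤ S * ((5 * S / Δ) ^ 3)⁻¹ :=
        mul_le_mul hu (h1.trans h2) (Real.exp_pos _).le hS0.le
    _ = Δ ^ 3 / (125 * S ^ 2) := by field_simp; norm_num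
    _ ≤ Δ / (8 * S) := by
        rw [div_le_div_iff₀ (by positivity) (by positivity)]
        have h3 : Δ ^ 3 ≤ Δ := by
          have := pow_le_pow_of_le_one hΔ.le hΔ1 (show 1 ≤ 3 by norm_num)
          simpa using this
        have h4 : 8 * S ≤ 125 * S ^ 2 := by nlinarith
        exact mul_le_mul h3 h4 (by positivity) hΔ.le
    _ ≤ Δ / (4 * (S + τ)) := by
        apply div_le_div_of_nonneg_left hΔ.le (by positivity)
        linarith

theorem ceil_le_mul {C s L P : ℝ} (hC : 0 ≤ C) (hs : 0 ≤ s) (hL : L ≤ 4 * P) (hsP : 1 ≤ s * P) :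
    (⌈C * s * L⌉₊ : ℝ) ≤ (4 * C + 1) * (s * P) := by
  rcases le_total (C * s * L) 0 with h | h
  · rw [Nat.ceil_eq_zero.2 h, Nat.cast_zero]
    exact mul_nonneg (by linarith) (by linarith)
  · have h1 := (Nat.ceil_lt_add_one h).le
    have h2 : C * s * L ≤ C * s * (4 * P) := mul_le_mul_of_nonneg_left hL (by positivity)
    linarith

/-- The bound `1/(40M)` on `β` keeps the final gradient bound below `ε`; the bound `M/5` permits the
absorption in `epoch_descent`. -/
theorem exists_tolerances {l_f M : ℝ} (hl : 0 ≤ l_f) (hM : 0 < M) :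
    ∃ κ lam : ℝ, 0 < κ ∧ 0 < lam ∧
      10 * l_f * κ + 200 * l_f ^ 2 * lam ^ 2 / M ≤ 1 / (40 * M) ∧
      10 * l_f * κ + 200 * l_f ^ 2 * lam ^ 2 / M ≤ M / 5 := by
  set c := min (1 / (40 * M)) (M / 5) with hc
  have hc0 : 0 < c := lt_min (by positivity) (by positivity)
  refine ⟨c / (20 * (l_f + 1)), √(c * M / (400 * (l_f + 1) ^ 2)), by positivity,
    Real.sqrt_pos.2 (by positivity), ?_⟩
  rw [Real.sq_sqrt (by positivity), ← le_min_iff, ← hc]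
  have h1 : 10 * l_f * (c / (20 * (l_f + 1))) ≤ c / 2 := by
    rw [← mul_div_assoc, div_le_div_iff₀ (by positivity) (by positivity)]
    nlinarith
  have h2 : 200 * l_f ^ 2 * (c * M / (400 * (l_f + 1) ^ 2)) / M ≤ c / 2 := by
    rw [← mul_div_assoc, div_div, div_le_div_iff₀ (by positivity) (by positivity)]
    have : 0 ≤ c * M := by positivity
    nlinarith [mul_nonneg this hl]
  linarith

end Parameters


/-! ### Numerical bounds in powers of `z = ε^(-1/3)` -/

section FinalBounds

/-- The batch constants `24 = 3 · 8` and `96 = 3 · 32` are chosen so that the Hoeffding exponent is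
three times the logarithm, as `tail_le` requires. -/
theorem rate_le {N C s L t d : ℝ} (hN : C * s * L ≤ N) (hd : 0 < d) (h : C * s * t ^ 2 / d = 3) :
    3 * L ≤ N * t ^ 2 / d := by
  rw [← h, div_mul_eq_mul_div]
  apply div_le_div_of_nonneg_right _ hd.le
  nlinarith [mul_le_mul_of_nonneg_right hN (sq_nonneg t)]

/-- The total number of calls, from bounds on the batch sizes, on the number of epochs and on the
number of iterations. -/
theorem total_calls_le {A a K I α α' cK cI s s' z r P : ℝ} (hα' : 0 ≤ α') (hα : 0 ≤ α)
    (hA : A ≤ α * (s * P)) (ha : a ≤ α' * (s' * P)) (hK0 : 0 ≤ K) (hI0 : 0 ≤ I)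
    (hK : K ≤ cK * z ^ 2) (hI : I ≤ cI * z ^ 3) (hs0 : 0 ≤ s * P) (hs0' : 0 ≤ s' * P)
    (hs : s * z ^ 2 = r) (hs' : s' * z ^ 3 = r) :
    A * K + 2 * a * I ≤ (α * cK + 2 * α' * cI) * r * P := by
  have h1 : A * K ≤ α * (s * P) * (cK * z ^ 2) :=
    (mul_le_mul_of_nonneg_right hA hK0).trans (mul_le_mul_of_nonneg_left hK (by positivity))
  have h2 : a * I ≤ α' * (s' * P) * (cI * z ^ 3) :=
    (mul_le_mul_of_nonneg_right ha hI0).trans (mul_le_mul_of_nonneg_left hI (by positivity))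
  calc A * K + 2 * a * I ≤ α * (s * P) * (cK * z ^ 2) + 2 * (α' * (s' * P) * (cI * z ^ 3)) := by
        linarith
    _ = α * cK * (s * z ^ 2) * P + 2 * α' * cI * (s' * z ^ 3) * P := by ring
    _ = (α * cK + 2 * α' * cI) * r * P := by rw [hs, hs']; ring

theorem badBatch_eq_empty {n : ℕ} {Ξ E : Type*} [NormedAddCommGroup E] [NormedSpace ℝ E]
    [Subsingleton E] {H : Ξ → Vec n → E} {c : Vec n → E} {N₀ N₁ : ℕ} {t₀ t₁ : ℝ} (h₀ : 0 ≤ t₀)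
    (h₁ : 0 ≤ t₁) (k i : ℕ) (q : Vec n × Vec n) : badBatch H c N₀ N₁ t₀ t₁ k i q = ∅ := by
  have hz : ∀ e : E, ‖e‖ = 0 := fun e => by rw [Subsingleton.elim e 0, norm_zero]
  ext ω
  simp only [badBatch, Set.mem_ofPred_eq, hz, Set.mem_empty_iff_false, iff_false]
  split_ifs
  · exact not_lt.2 h₀
  · exact not_lt.2 (mul_nonneg h₁ (norm_nonneg _))

/-- The three terms contribute at most `ε/4`, exactly `32ε/150` and at most `ε/4`. -/
theorem gradient_bound_le {M Γ ε S β ebar : ℝ} (hM : 0 < M) (hε : 0 < ε) (hS0 : 0 < S)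
    (hS : 40 * M * (|Γ| + 1) * ε⁻¹ ≤ S) (hβ : β ≤ 1 / (40 * M)) (he : ebar = ε / (5 * 30 * M)) :
    10 * M * (|Γ| / S + 16 / 5 * ebar + β * ε) ≤ ε := by
  have h1 : 10 * M * (|Γ| / S) ≤ ε / 4 := by
    rw [← mul_div_assoc, div_le_iff₀ hS0]
    have h2 : ε / 4 * (40 * M * (|Γ| + 1) * ε⁻¹) = 10 * M * (|Γ| + 1) := by field_simp; norm_num
    have h3 := mul_le_mul_of_nonneg_left hS (show 0 ≤ ε / 4 by positivity)
    linarith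
  have h2 : 10 * M * (16 / 5 * ebar) = 32 / 150 * ε := by rw [he]; field_simp; norm_num
  have h3 : 10 * M * (β * ε) ≤ ε / 4 := by
    have h4 : 10 * M * (β * ε) ≤ 10 * M * (1 / (40 * M) * ε) := by gcongr
    have h5 : 10 * M * (1 / (40 * M) * ε) = ε / 4 := by field_simp; norm_num
    linarith
  have h4 : 10 * M * (|Γ| / S + 16 / 5 * ebar + β * ε) =
      10 * M * (|Γ| / S) + 10 * M * (16 / 5 * ebar) + 10 * M * (β * ε) := by ring
  linarith

theorem ceil_bounds {z : ℝ} (hz : 1 ≤ z) : z ≤ (⌈z⌉₊ : ℝ) ∧ (⌈z⌉₊ : ℝ) ≤ 2 * z := by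
  have := (Nat.ceil_lt_add_one (show 0 ≤ z by linarith)).le
  exact ⟨Nat.le_ceil z, by linarith⟩

theorem iteration_bounds {C z u : ℝ} {S : ℕ} (hC : 0 < C) (hz : 1 ≤ z) (hu : 0 ≤ u)
    (huz : (u + 3) / C ≤ z) (hS : S = ⌈C * z ^ 3⌉₊) :
    C * z ^ 3 ≤ S ∧ (S : ℝ) ≤ (C + 1) * z ^ 3 ∧ u ≤ S ∧ (1 : ℝ) ≤ S ∧ 2 * z ≤ S := by
  have hz0 : 0 < z := by linarith
  have hlow : C * z ^ 3 ≤ S := hS ▸ Nat.le_ceil _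
  have hup := (Nat.ceil_lt_add_one (show 0 ≤ C * z ^ 3 by positivity)).le
  rw [← hS] at hup
  have hz3 : 1 ≤ z ^ 3 := one_le_pow₀ hz
  rw [div_le_iff₀ hC] at huz
  have hzz : z ≤ z * z := by nlinarith
  have h1 : (u + 3) * z ≤ C * z ^ 3 := by nlinarith
  have h2 : u ≤ u * z := le_mul_of_one_le_right hu hz
  refine ⟨hlow, by linarith, by linarith, by linarith, by nlinarith⟩

/-- The source of the dependence of `ε₀` on `Δ₀`: `log(1/ε)` must outweigh `1/log(1/Δ₀)`, which
blows up as `Δ₀ → 1`. -/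
theorem log_bounds {ε Δ Δ₀ z : ℝ} (hz : z ^ 3 = ε⁻¹) (hΔ : 0 < Δ)
    (hΔ₀ : Δ ≤ Δ₀) (hΔ₀1 : Δ₀ < 1) (hz0 : 0 < z)
    (hexp : Real.exp (1 + 1 / Real.log (1 / Δ₀)) ≤ z) :
    1 ≤ Real.log (1 / ε) ∧ 1 ≤ Real.log (1 / ε) * Real.log (1 / Δ) := by
  have hΔ₀0 : 0 < Δ₀ := hΔ.trans_le hΔ₀
  have hpos : 0 < Real.log (1 / Δ₀) := Real.log_pos (by rw [lt_div_iff₀ hΔ₀0]; linarith)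
  have hlogz : Real.log (1 / ε) = 3 * Real.log z := by
    rw [one_div, ← hz, Real.log_pow]; norm_num
  have hlogz1 : 1 + 1 / Real.log (1 / Δ₀) ≤ Real.log z := (Real.le_log_iff_exp_le hz0).2 hexp
  have hinv0 : 0 < 1 / Real.log (1 / Δ₀) := by positivity
  have hΔlog : Real.log (1 / Δ₀) ≤ Real.log (1 / Δ) :=
    Real.log_le_log (by positivity) (one_div_le_one_div_of_le hΔ hΔ₀)
  refine ⟨by linarith, ?_⟩
  calc (1 : ℝ) = 1 / Real.log (1 / Δ₀) * Real.log (1 / Δ₀) := by field_simp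
    _ ≤ Real.log (1 / ε) * Real.log (1 / Δ) :=
      mul_le_mul (by linarith) hΔlog hpos.le (by linarith)

/-- `T` is twice the number of epochs that would suffice on average. Its lower bound feeds the
exponential tail, its upper bound the cost of the large batches. -/
theorem epoch_number_bounds {C B S τ z : ℝ} {T : ℕ} (hC : 0 < C) (hB : 0 < B) (hz : 1 ≤ z)
    (hτ : z ≤ τ) (hτ' : τ ≤ 2 * z) (hS : B * z ^ 3 ≤ S) (hS' : S ≤ (B + 1) * z ^ 3)
    (hT : T = ⌈2 * C * S / τ⌉₊) :
    S ≤ T * τ / (2 * C) ∧ B / (8 * C) * z ^ 2 ≤ T / (8 * C ^ 2) ∧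
      (T : ℝ) ≤ (2 * C * (B + 1) + 1) * z ^ 2 := by
  have hz0 : 0 < z := by linarith
  have hτ0 : 0 < τ := by linarith
  have hS0 : 0 ≤ S := le_trans (by positivity) hS
  have hTlow : 2 * C * S / τ ≤ T := hT ▸ Nat.le_ceil _
  refine ⟨?_, ?_, ?_⟩
  · rw [le_div_iff₀ (by positivity)]
    rw [div_le_iff₀ hτ0] at hTlow
    linarith
  · have hSτ : B / 2 * z ^ 2 ≤ S / τ := by
      rw [le_div_iff₀ hτ0]
      have : B / 2 * z ^ 2 * τ ≤ B / 2 * z ^ 2 * (2 * z) := by gcongr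
      linarith
    calc B / (8 * C) * z ^ 2 = 2 * C * (B / 2 * z ^ 2) / (8 * C ^ 2) := by field_simp
      _ ≤ 2 * C * (S / τ) / (8 * C ^ 2) := by gcongr
      _ ≤ T / (8 * C ^ 2) := by
          rw [← mul_div_assoc]
          gcongr
  · have h1 := (Nat.ceil_lt_add_one (show 0 ≤ 2 * C * S / τ by positivity)).le
    rw [← hT] at h1
    have h2 : 2 * C * S / τ ≤ 2 * C * (B + 1) * z ^ 2 := by
      rw [div_le_iff₀ hτ0]
      calc 2 * C * S ≤ 2 * C * ((B + 1) * z ^ 3) := by gcongr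
        _ = 2 * C * (B + 1) * z ^ 2 * z := by ring
        _ ≤ 2 * C * (B + 1) * z ^ 2 * τ := by gcongr
    have h3 : (1 : ℝ) ≤ z ^ 2 := one_le_pow₀ hz
    linarith

theorem value_batch_bounds {C_A C_a z ε L P : ℝ} {τ A a : ℕ} (hA : 0 ≤ C_A) (ha : 0 ≤ C_a)
    (hz : 1 ≤ z) (hz3 : ε⁻¹ = z ^ 3) (hτ : z ≤ τ) (hτ' : (τ : ℝ) ≤ 2 * z) (hL : L ≤ 4 * P)
    (hP : 1 ≤ P) (hNA : A = ⌈C_A * (ε ^ 2)⁻¹ * L⌉₊)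
    (hNa : a = ⌈C_a * (τ : ℝ) ^ 2 * ε⁻¹ * L⌉₊) :
    (A : ℝ) ≤ (4 * C_A + 1) * (z ^ 6 * P) ∧ (a : ℝ) ≤ 4 * (4 * C_a + 1) * (z ^ 5 * P) := by
  have hz0 : 0 < z := by linarith
  have hone : ∀ {s : ℝ}, 1 ≤ s → 1 ≤ s * P := fun h1 => one_le_mul_of_one_le_of_one_le h1 hP
  have hεz6 : (ε ^ 2)⁻¹ = z ^ 6 := by rw [← inv_pow, hz3]; ring
  constructor
  · rw [hNA, hεz6]
    exact ceil_le_mul hA (by positivity) hL (hone (one_le_pow₀ hz))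
  · rw [hNa, hz3, mul_assoc C_a]
    refine (ceil_le_mul ha (by positivity) hL
      (hone (one_le_mul_of_one_le_of_one_le (one_le_pow₀ (hz.trans hτ)) (one_le_pow₀ hz)))).trans ?_
    calc (4 * C_a + 1) * ((τ : ℝ) ^ 2 * z ^ 3 * P) ≤
          (4 * C_a + 1) * ((2 * z) ^ 2 * z ^ 3 * P) := by gcongr
      _ = _ := by ring

theorem jacobian_batch_bounds {C_B C_b z ε L P : ℝ} {τ B b : ℕ} (hB : 0 ≤ C_B) (hb : 0 ≤ C_b)
    (hz : 1 ≤ z) (hz3 : ε⁻¹ = z ^ 3) (hτ : z ≤ τ) (hτ' : (τ : ℝ) ≤ 2 * z) (hL : L ≤ 4 * P)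
    (hP : 1 ≤ P) (hNB : B = ⌈C_B * ε⁻¹ * L⌉₊) (hNb : b = ⌈C_b * (τ : ℝ) ^ 2 * L⌉₊) :
    (B : ℝ) ≤ (4 * C_B + 1) * (z ^ 3 * P) ∧ (b : ℝ) ≤ 4 * (4 * C_b + 1) * (z ^ 2 * P) := by
  have hz0 : 0 < z := by linarith
  have hone : ∀ {s : ℝ}, 1 ≤ s → 1 ≤ s * P := fun h1 => one_le_mul_of_one_le_of_one_le h1 hP
  constructor
  · rw [hNB, hz3]
    exact ceil_le_mul hB (by positivity) hL (hone (one_le_pow₀ hz))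
  · rw [hNb]
    refine (ceil_le_mul hb (by positivity) hL (hone (one_le_pow₀ (hz.trans hτ)))).trans ?_
    calc (4 * C_b + 1) * ((τ : ℝ) ^ 2 * P) ≤ (4 * C_b + 1) * ((2 * z) ^ 2 * P) := by gcongr
      _ = _ := by ring

end FinalBounds

/-! ### Batch failure probabilities and the guarantee for a whole run -/

section Guarantee

variable {m n : ℕ} {Ξ Seed Θ : Type*} [MeasurableSpace Ξ] [MeasurableSpace Seed]
  {D : Measure Ξ} [IsProbabilityMeasure D] {Q : Measure Seed} [IsProbabilityMeasure Q]
  {f : Vec m → ℝ} {h : Vec n → EReal} {G : Ξ → Vec n → Vec m} {M : ℝ}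
  {solver : Solver n Seed} {ebar dbar : ℝ} {N : BatchSizes} {xinit : Vec n}

theorem measure_badValue_le {σ_g σ_J lhat Lhat κ ε Δ : ℝ} {τplus S : ℕ}
    {U : Finset (Vec m →L[ℝ] ℝ)} (hU : ∀ u ∈ U, ‖u‖ ≤ 1) (hU' : ∀ z, ∃ u ∈ U, ‖z‖ ≤ 2 * u z)
    (hO : OracleRegularity D G) (hdev : BoundedDeviation D G σ_g σ_J)
    (hlip : UniformLipschitz D G lhat Lhat) (hκ : 0 < κ) (hε : 0 < ε) (hΔ : 0 < Δ) (hΔ1 : Δ ≤ 1)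
    (hS : (1 : ℝ) ≤ S) (hUS : (U.card : ℝ) ≤ S) (hτ : (0 : ℝ) < τplus) (hτS : (τplus : ℝ) ≤ S)
    (hA : 24 * (|σ_g| + 1) ^ 2 / κ ^ 2 * (ε ^ 2)⁻¹ *
      Real.log (5 * ((m : ℝ) + 1) * (S : ℝ) / Δ) ≤ N.A)
    (ha : 96 * (|lhat| + 1) ^ 2 / κ ^ 2 * ((τplus : ℝ) ^ 2 * ε⁻¹) *
      Real.log (5 * ((m : ℝ) + 1) * (S : ℝ) / Δ) ≤ N.a) (k i : ℕ) (q : Vec n × Vec n) :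
    (Measure.infinitePi fun _ : ℕ × ℕ × ℕ => D)
      (badBatch G (innerMap D G) N.A N.a (κ * ε) (κ * √ε / τplus) k i q) ≤
        ENNReal.ofReal (Δ / (4 * ((S : ℝ) + τplus))) := by
  have hm : (1 : ℝ) ≤ (m : ℝ) + 1 := by linarith [Nat.cast_nonneg (α := ℝ) m]
  have hsqε : √ε ^ 2 = ε := Real.sq_sqrt hε.le
  refine measure_badBatch_le D hU hU' hO.measurable_value hO.integrable (fun _ => rfl)
    (σ := |σ_g| + 1) (ℓ := |lhat| + 1) (by positivity) (by positivity)
    (hdev.value.mono fun ξ hξ x => (hξ x).trans (by linarith [le_abs_self σ_g]))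
    (hlip.value.mono fun ξ hξ x y => (hξ x y).trans (mul_le_mul_of_nonneg_right
      (by linarith [le_abs_self lhat]) (norm_nonneg _))) (by positivity) (by positivity)
    ?_ ?_ k i q
  · refine tail_le hm hS hΔ hΔ1 hUS hτ.le hτS (rate_le hA (by positivity) ?_)
    field_simp
    norm_num
  · refine tail_le hm hS hΔ hΔ1 hUS hτ.le hτS (rate_le ha (by positivity) ?_)
    rw [div_pow, mul_pow, hsqε]
    field_simp
    norm_num

theorem measure_badJacobian_le {σ_g σ_J lhat Lhat κ ε Δ : ℝ} {τplus S : ℕ}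
    {U : Finset ((Vec n →L[ℝ] Vec m) →L[ℝ] ℝ)} (hU : ∀ u ∈ U, ‖u‖ ≤ 1)
    (hU' : ∀ z, ∃ u ∈ U, ‖z‖ ≤ 2 * u z)
    (hO : OracleRegularity D G) (hdev : BoundedDeviation D G σ_g σ_J)
    (hlip : UniformLipschitz D G lhat Lhat) (hκ : 0 < κ) (hε : 0 < ε) (hΔ : 0 < Δ) (hΔ1 : Δ ≤ 1)
    (hS : (1 : ℝ) ≤ S) (hUS : (U.card : ℝ) ≤ S) (hτ : (0 : ℝ) < τplus) (hτS : (τplus : ℝ) ≤ S)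
    (hB : 24 * (|σ_J| + 1) ^ 2 / κ ^ 2 * ε⁻¹ *
      Real.log (5 * ((m : ℝ) + n) * (S : ℝ) / Δ) ≤ N.B)
    (hb : 96 * (|Lhat| + 1) ^ 2 / κ ^ 2 * (τplus : ℝ) ^ 2 *
      Real.log (5 * ((m : ℝ) + n) * (S : ℝ) / Δ) ≤ N.b) (k i : ℕ) (q : Vec n × Vec n) :
    (Measure.infinitePi fun _ : ℕ × ℕ × ℕ => D)
      (badBatch (fun ξ => fderiv ℝ (G ξ)) (fderiv ℝ (innerMap D G)) N.B N.b (κ * √ε)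
        (κ / τplus) k i q) ≤ ENNReal.ofReal (Δ / (4 * ((S : ℝ) + τplus))) := by
  -- For `m = n = 0` the logarithm is `log 0 = 0`, so it forces no samples; but then all Jacobians
  -- vanish and no batch is bad.
  rcases Nat.eq_zero_or_pos (m + n) with hmn | hmn
  · obtain ⟨rfl, rfl⟩ : m = 0 ∧ n = 0 := by omega
    have : Subsingleton (Vec 0 →L[ℝ] Vec 0) :=
      ⟨fun A B => ContinuousLinearMap.ext fun x => Subsingleton.elim _ _⟩
    rw [badBatch_eq_empty (by positivity) (by positivity), measure_empty]
    exact zero_le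
  have hm : (1 : ℝ) ≤ (m : ℝ) + n := by exact_mod_cast hmn
  have hsqε : √ε ^ 2 = ε := Real.sq_sqrt hε.le
  refine measure_badBatch_le D hU hU' (H := fun ξ => fderiv ℝ (G ξ)) hO.measurable_jacobian
    (integrable_fderiv hO hlip) (integral_fderiv hO hlip)
    (σ := |σ_J| + 1) (ℓ := |Lhat| + 1) (by positivity) (by positivity)
    (hdev.jacobian.mono fun ξ hξ x => (hξ x).trans (by linarith [le_abs_self σ_J]))
    (hlip.jacobian.mono fun ξ hξ x y => (hξ x y).trans (mul_le_mul_of_nonneg_right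
      (by linarith [le_abs_self Lhat]) (norm_nonneg _))) (by positivity) (by positivity)
    ?_ ?_ k i q
  · refine tail_le hm hS hΔ hΔ1 hUS hτ.le hτS (rate_le hB (by positivity) ?_)
    rw [mul_pow, hsqε]
    field_simp
    norm_num
  · refine tail_le hm hS hΔ hΔ1 hUS hτ.le hτS (rate_le hb (by positivity) ?_)
    rw [div_pow]
    field_simp
    norm_num

/-- With high probability the run is good, it has few epochs, and it is not much longer than
required. -/
theorem run_guarantee {l_f l_g L_g κ lam β Γ ε Δ C_τ C : ℝ} {Dτ : ℕ → Θ → PMF ℕ} {θ : Θ}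
    {τplus S T : ℕ}
    (hl : 0 ≤ l_f) (hL : 0 ≤ L_g) (hM : 5 * l_f * L_g < M)
    (hO : OracleRegularity D G) (hs : StandingAssumptions f (innerMap D G) h l_f l_g L_g)
    (hbot : ⊥ < ⨅ x, objective f (innerMap D G) h x)
    (hinit : objective f (innerMap D G) h xinit ≤
      (⨅ x, objective f (innerMap D G) h x) + (Γ : EReal))
    (hsol : SolverAssumption f h M Q solver) (hDτ : EpochLawAssumption Dτ C_τ)
    (hκ : 0 < κ) (hβ : β = 10 * l_f * κ + 200 * l_f ^ 2 * lam ^ 2 / M)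
    (hβ₁ : β ≤ 1 / (40 * M)) (hβ₂ : β ≤ M / 5) (hε : 0 < ε) (hΔ : 0 < Δ) (hτ : 1 ≤ τplus)
    (hS : (1 : ℝ) ≤ S) (hSε : 40 * M * (|Γ| + 1) * ε⁻¹ ≤ S)
    (hC : 0 < C) (hC' : C_τ ≤ C) (hT : (S : ℝ) ≤ T * τplus / (2 * C))
    (hdbar : dbar = Δ / (2 * ((S : ℝ) + (τplus : ℝ)))) (hebar : ebar = ε / (5 * 30 * M))
    (hA : ∀ k i q, (Measure.infinitePi fun _ : ℕ × ℕ × ℕ => D)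
      (badBatch G (innerMap D G) N.A N.a (κ * ε) (κ * √ε / τplus) k i q) ≤
        ENNReal.ofReal (Δ / (4 * ((S : ℝ) + τplus))))
    (hB : ∀ k i q, (Measure.infinitePi fun _ : ℕ × ℕ × ℕ => D)
      (badBatch (fun ξ => fderiv ℝ (G ξ)) (fderiv ℝ (innerMap D G)) N.B N.b (lam * √ε)
        (lam / τplus) k i q) ≤ ENNReal.ofReal (Δ / (4 * ((S : ℝ) + τplus)))) :
    1 - Δ - Real.exp (-(T / (8 * C ^ 2))) ≤ (inputLaw (Dτ τplus θ) D Q).real {w |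
      averageSqGradient D f h G M solver ebar dbar N xinit S w ≤ ε ∧
      epochCount S w.1 ≤ T ∧ totalIterations S w.1 ≤ S + τplus} := by
  have hM0 : 0 < M := by nlinarith [mul_nonneg hl hL]
  have hsum0 : 0 < (S : ℝ) + τplus := by positivity
  have hd0 : 0 < dbar := by rw [hdbar]; positivity
  have he0 : 0 < ebar := by rw [hebar]; positivity
  have hνsupp := hDτ.support_subset τplus θ hτ
  have hbad := inputLaw_not_good_le (N := N) (xinit := xinit) (S := S) hO hs hsol he0 hd0 hνsupp
    (p := Δ / (4 * ((S : ℝ) + τplus))) (by positivity) hA hB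
  -- The failure budget: `Δ/4` for values, `Δ/4` for Jacobians and `Δ/2` for the solver.
  have hbadΔ : ((S : ℝ) + τplus) * (Δ / (4 * ((S : ℝ) + τplus)) +
      Δ / (4 * ((S : ℝ) + τplus)) + dbar) = Δ := by
    rw [hdbar]
    field_simp
    norm_num
  rw [hbadΔ] at hbad
  have hmean : (τplus : ℝ) ≤ C * ∫ t, (t : ℝ) ∂(Dτ τplus θ).toMeasure :=
    (hDτ.mean_ge τplus θ hτ).trans (mul_le_mul_of_nonneg_right hC'
      (integral_nonneg fun t => Nat.cast_nonneg t))
  refine inputLaw_good_ge (D := D) (Q := Q) (T := T) (S := S) hνsupp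
    (good := {w | ∀ k i, ∑ j ∈ Finset.range k, w.1 j < S → i < w.1 k →
      GoodAt D f h G M solver ebar dbar N xinit (κ * ε) (κ * √ε / τplus) (lam * √ε)
        (lam / τplus) w k i}) hbad (measure_sum_lt_le (S := S) hνsupp hτ hC hmean hT) ?_
  intro w hw hτw hSw
  refine ⟨?_, epochCount_le hSw, totalIterations_le fun k => (hτw k).2⟩
  have hinit' : objective f (innerMap D G) h xinit ≤
      (⨅ x, objective f (innerMap D G) h x) + ((|Γ| : ℝ) : EReal) :=
    hinit.trans (add_le_add_right (EReal.coe_le_coe_iff.2 (le_abs_self Γ)) _)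
  exact (averageSqGradient_le hs hl hL hM hbot hinit' (abs_nonneg Γ) hε.le hκ.le hβ hβ₂
    (by exact_mod_cast hS) hτw hw).trans
      (gradient_bound_le hM0 hε (by linarith) hSε hβ₁ hebar)

end Guarantee

end VRProxLinear

/-! ### The main theorem -/

theorem corollary10
    (l_f l_g L_g σ_g σ_J lhat Lhat M Γ C_τ : ℝ)
    (hl_f : 0 ≤ l_f) (hL_g : 0 ≤ L_g) (hM : 5 * l_f * L_g < M) :
    ∃ (C_S C_A C_B C_a C_b C_p C_cost : ℝ) (p : ℕ),
      0 < C_S ∧ 0 < C_A ∧ 0 < C_B ∧ 0 < C_a ∧ 0 < C_b ∧ 0 < C_p ∧ 0 < C_cost ∧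
      ∀ (m n : ℕ) (Δ₀ : ℝ), 0 < Δ₀ → Δ₀ < 1 →
      ∃ ε₀ : ℝ, 0 < ε₀ ∧
      ∀ (ε Δ : ℝ), 0 < ε → ε < ε₀ → 0 < Δ → Δ ≤ Δ₀ →
      -- the problem
      ∀ (Ξ : Type*) [MeasurableSpace Ξ] (D : Measure Ξ) [IsProbabilityMeasure D]
        (G : Ξ → Vec n → Vec m) (f : Vec m → ℝ) (h : Vec n → EReal) (xinit : Vec n),
        OracleRegularity D G →
        StandingAssumptions f (innerMap D G) h l_f l_g L_g →
        BoundedDeviation D G σ_g σ_J →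
        UniformLipschitz D G lhat Lhat →
        ⊥ < ⨅ x, objective f (innerMap D G) h x →
        objective f (innerMap D G) h xinit ≤ (⨅ x, objective f (innerMap D G) h x) + (Γ : EReal) →
      -- the solver
      ∀ (Seed : Type*) [MeasurableSpace Seed] (Q : Measure Seed) [IsProbabilityMeasure Q]
        (solver : Solver n Seed), SolverAssumption f h M Q solver →
      -- the law of the epoch lengths
      ∀ (Θ : Type*) (Dτ : ℕ → Θ → PMF ℕ), EpochLawAssumption Dτ C_τ → ∀ θ : Θ,
      -- the parameters
      ∀ (τplus S : ℕ) (N : BatchSizes) (ebar dbar : ℝ),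
        τplus = ⌈ε ^ (-(1 / 3) : ℝ)⌉₊ →
        S = ⌈C_S * ε⁻¹⌉₊ →
        N.A = ⌈C_A * (ε ^ 2)⁻¹ * Real.log (5 * ((m : ℝ) + 1) * (S : ℝ) / Δ)⌉₊ →
        N.B = ⌈C_B * ε⁻¹ * Real.log (5 * ((m : ℝ) + (n : ℝ)) * (S : ℝ) / Δ)⌉₊ →
        N.a = ⌈C_a * (τplus : ℝ) ^ 2 * ε⁻¹ * Real.log (5 * ((m : ℝ) + 1) * (S : ℝ) / Δ)⌉₊ →
        N.b = ⌈C_b * (τplus : ℝ) ^ 2 * Real.log (5 * ((m : ℝ) + (n : ℝ)) * (S : ℝ) / Δ)⌉₊ →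
        dbar = Δ / (2 * ((S : ℝ) + (τplus : ℝ))) →
        ebar = ε / (5 * 30 * M) →
        1 - Δ - Real.exp (-(C_p * ε ^ (-(2 / 3) : ℝ))) ≤
          (inputLaw (Dτ τplus θ) D Q).real {w |
            averageSqGradient D f h G M solver ebar dbar N xinit S w ≤ ε ∧
            (valueCalls N S w.1 : ℝ) ≤
              C_cost * ε ^ (-(8 / 3) : ℝ) * Real.log (1 / ε) ^ p * Real.log (1 / Δ) ∧
            (jacobianCalls N S w.1 : ℝ) ≤
              C_cost * ε ^ (-(5 / 3) : ℝ) * Real.log (1 / ε) ^ p * Real.log (1 / Δ)} := by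
  have hM0 : 0 < M := by nlinarith [mul_nonneg hl_f hL_g]
  obtain ⟨κ, lam, hκ, hlam, hβ₁, hβ₂⟩ := exists_tolerances hl_f hM0
  -- `C_S` makes the initial gap contribute at most `ε/4` to the average. Absolute values plus one
  -- keep the constants positive whatever the signs of the parameters. The constants stay opaque
  -- behind their defining equations.
  obtain ⟨C_S, hC_S⟩ : ∃ x, x = 40 * M * (|Γ| + 1) := ⟨_, rfl⟩
  obtain ⟨Cτ, hCτ⟩ : ∃ x, x = |C_τ| + 1 := ⟨_, rfl⟩
  obtain ⟨C_A, hC_A⟩ : ∃ x, x = 24 * (|σ_g| + 1) ^ 2 / κ ^ 2 := ⟨_, rfl⟩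
  obtain ⟨C_B, hC_B⟩ : ∃ x, x = 24 * (|σ_J| + 1) ^ 2 / lam ^ 2 := ⟨_, rfl⟩
  obtain ⟨C_a, hC_a⟩ : ∃ x, x = 96 * (|lhat| + 1) ^ 2 / κ ^ 2 := ⟨_, rfl⟩
  obtain ⟨C_b, hC_b⟩ : ∃ x, x = 96 * (|Lhat| + 1) ^ 2 / lam ^ 2 := ⟨_, rfl⟩
  have hC_S0 : 0 < C_S := by rw [hC_S]; positivity
  have hCτ0 : 0 < Cτ := by rw [hCτ]; positivity
  have hC_A0 : 0 < C_A := by rw [hC_A]; positivity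
  have hC_B0 : 0 < C_B := by rw [hC_B]; positivity
  have hC_a0 : 0 < C_a := by rw [hC_a]; positivity
  have hC_b0 : 0 < C_b := by rw [hC_b]; positivity
  obtain ⟨costA, hcostA⟩ : ∃ x, x = (4 * C_A + 1) * (2 * Cτ * (C_S + 1) + 1) +
    2 * (4 * (4 * C_a + 1)) * (2 * (C_S + 1)) := ⟨_, rfl⟩
  obtain ⟨costB, hcostB⟩ : ∃ x, x = (4 * C_B + 1) * (2 * Cτ * (C_S + 1) + 1) +
    2 * (4 * (4 * C_b + 1)) * (2 * (C_S + 1)) := ⟨_, rfl⟩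
  have hcostA0 : 0 < costA := by rw [hcostA]; positivity
  have hcostB0 : 0 < costB := by rw [hcostB]; positivity
  refine ⟨C_S, C_A, C_B, C_a, C_b, C_S / (8 * Cτ), costA + costB, 2, hC_S0, hC_A0, hC_B0, hC_a0,
    hC_b0, by positivity, by positivity, ?_⟩
  intro m n Δ₀ hΔ₀ hΔ₀1
  obtain ⟨U₁, hU₁, hU₁'⟩ := exists_norming_finset (Vec m)
  obtain ⟨U₂, hU₂, hU₂'⟩ := exists_norming_finset (Vec n →L[ℝ] Vec m)
  -- A sum of nonnegative requirements on `z`: `z ≥ 1`, constants swallowed in the logarithm,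
  -- norming sets smaller than `S`, and the comparison of the two logarithms.
  obtain ⟨ε₀, hε₀, hthr⟩ := exists_threshold (1 + 5 * ((m : ℝ) + n + 1) * (C_S + 1) +
    (U₁.card + U₂.card + 3) / C_S + Real.exp (1 + 1 / Real.log (1 / Δ₀)))
  refine ⟨ε₀, hε₀, ?_⟩
  intro ε Δ hε hεε₀ hΔ hΔle Ξ _ D _ G f h xinit hO hs hdev hlip hbot hinit Seed _ Q _ solver hsol
    Θ Dτ hDτ θ τplus S N ebar dbar hτplus hS hNA hNB hNa hNb hdbar hebar
  have hΔ1 : Δ ≤ 1 := hΔle.trans hΔ₀1.le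
  have hz3 := cube_root_inv_pow hε 3 (r := -1) (by norm_num)
  rw [Real.rpow_neg_one] at hz3
  rw [cube_root_inv_pow hε 2 (r := -(2 / 3)) (by norm_num),
    cube_root_inv_pow hε 8 (r := -(8 / 3)) (by norm_num),
    cube_root_inv_pow hε 5 (r := -(5 / 3)) (by norm_num)]
  have hzthr := hthr ε hε hεε₀
  generalize ε ^ (-(1 / 3) : ℝ) = z at *
  have hmn0 : (0 : ℝ) ≤ 5 * ((m : ℝ) + n + 1) * (C_S + 1) := by positivity
  have hcard0 : (0 : ℝ) ≤ (U₁.card + U₂.card + 3) / C_S := by positivity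
  have hexp0 := Real.exp_pos (1 + 1 / Real.log (1 / Δ₀))
  have hz1 : 1 ≤ z := by linarith only [hmn0, hcard0, hexp0, hzthr]
  have hzm : 5 * ((m : ℝ) + n + 1) * (C_S + 1) ≤ z := by linarith only [hcard0, hexp0, hzthr]
  have hzU : (U₁.card + U₂.card + 3) / C_S ≤ z := by linarith only [hmn0, hexp0, hzthr]
  have hzexp : Real.exp (1 + 1 / Real.log (1 / Δ₀)) ≤ z := by linarith only [hmn0, hcard0, hzthr]
  have hz0 : 0 < z := zero_lt_one.trans_le hz1
  obtain ⟨hL1, hL2⟩ := log_bounds hz3.symm hΔ hΔle hΔ₀1 hz0 hzexp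
  obtain ⟨hτz, hτ2z⟩ := ceil_bounds hz1
  rw [← hτplus] at hτz hτ2z
  obtain ⟨hSlow, hSup, hUS, hS1, hzS⟩ := iteration_bounds (S := S) (u := U₁.card + U₂.card) hC_S0 hz1
    (by positivity) hzU (by rw [hS, hz3])
  have hU₁S : (U₁.card : ℝ) ≤ S := le_trans (le_add_of_nonneg_right (Nat.cast_nonneg _)) hUS
  have hU₂S : (U₂.card : ℝ) ≤ S := le_trans (le_add_of_nonneg_left (Nat.cast_nonneg _)) hUS
  have hτ0 : (0 : ℝ) < τplus := hz0.trans_le hτz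
  have hτ1 : 1 ≤ τplus := by exact_mod_cast hτ0
  have hτS : (τplus : ℝ) ≤ S := hτ2z.trans hzS
  obtain ⟨hTS, hTlow, hTup⟩ := epoch_number_bounds hCτ0 hC_S0 hz1 hτz hτ2z hSlow hSup rfl
  have hguar := run_guarantee (θ := θ) (C := Cτ) (N := N) hl_f hL_g hM hO hs hbot hinit hsol hDτ hκ
    rfl hβ₁ hβ₂ hε hΔ hτ1 hS1 (by rw [hz3, ← hC_S]; exact hSlow) hCτ0
    (by rw [hCτ]; exact (le_abs_self _).trans (le_add_of_nonneg_right zero_le_one)) hTS hdbar hebar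
    (measure_badValue_le hU₁ hU₁' hO hdev hlip hκ hε hΔ hΔ1 hS1 hU₁S hτ0 hτS
      (by rw [hNA, hC_A]; exact Nat.le_ceil _)
      (by rw [hNa, hC_a, mul_assoc _ _ ε⁻¹]; exact Nat.le_ceil _))
    (measure_badJacobian_le hU₂ hU₂' hO hdev hlip hlam hε hΔ hΔ1 hS1 hU₂S hτ0 hτS
      (by rw [hNB, hC_B]; exact Nat.le_ceil _) (by rw [hNb, hC_b]; exact Nat.le_ceil _))
  have hLA := log_factor_le (q := (m : ℝ) + 1) (Q := (m : ℝ) + n + 1) (c := C_S + 1) hz3.symm hz1 hΔ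
    (by positivity) (by linarith only [Nat.cast_nonneg (α := ℝ) n]) hS1 hSup hzm hL1 hL2
  have hLB := log_factor_le (q := (m : ℝ) + n) (Q := (m : ℝ) + n + 1) (c := C_S + 1) hz3.symm hz1 hΔ
    (by positivity) (le_add_of_nonneg_right zero_le_one) hS1 hSup hzm hL1 hL2
  have hP1 : 1 ≤ Real.log (1 / ε) ^ 2 * Real.log (1 / Δ) := by
    rw [sq, mul_assoc]
    exact one_le_mul_of_one_le_of_one_le hL1 hL2
  obtain ⟨hAle, hale⟩ := value_batch_bounds hC_A0.le hC_a0.le hz1 hz3 hτz hτ2z hLA hP1 hNA hNa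
  obtain ⟨hBle, hble⟩ := jacobian_batch_bounds hC_B0.le hC_b0.le hz1 hz3 hτz hτ2z hLB hP1 hNB hNb
  -- `hTlow` turns the tail in `T` into the one with `C_p = C_S / (8 Cτ)`; on the guaranteed event
  -- the cost bounds are deterministic.
  refine le_trans (sub_le_sub_left (Real.exp_le_exp.2 (neg_le_neg hTlow)) _)
    (hguar.trans (measureReal_mono ?_ ?_))
  · rintro w ⟨hgrad, hK, hI⟩
    have hK' : (epochCount S w.1 : ℝ) ≤ (2 * Cτ * (C_S + 1) + 1) * z ^ 2 :=
      le_trans (by exact_mod_cast hK) hTup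
    have hI' : (totalIterations S w.1 : ℝ) ≤ 2 * (C_S + 1) * z ^ 3 := by
      have h1 : (totalIterations S w.1 : ℝ) ≤ S + τplus := by exact_mod_cast hI
      linarith only [h1, hτS, hSup]
    have hP0 : 0 ≤ Real.log (1 / ε) ^ 2 * Real.log (1 / Δ) := zero_le_one.trans hP1
    refine ⟨hgrad, ?_, ?_⟩
    · have h1 : (valueCalls N S w.1 : ℝ) ≤
          N.A * epochCount S w.1 + 2 * N.a * totalIterations S w.1 := by
        exact_mod_cast sum_calls_le N.A N.a S w.1
      have h2 := total_calls_le (r := z ^ 8) (by positivity) (by positivity) hAle hale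
        (Nat.cast_nonneg _) (Nat.cast_nonneg _) hK' hI' (by positivity) (by positivity)
        (by ring) (by ring)
      rw [← hcostA] at h2
      rw [mul_assoc _ (Real.log (1 / ε) ^ 2)]
      refine (h1.trans h2).trans (mul_le_mul_of_nonneg_right
        (mul_le_mul_of_nonneg_right ?_ (by positivity)) hP0)
      exact le_add_of_nonneg_right hcostB0.le
    · have h1 : (jacobianCalls N S w.1 : ℝ) ≤
          N.B * epochCount S w.1 + 2 * N.b * totalIterations S w.1 := by
        exact_mod_cast sum_calls_le N.B N.b S w.1
      have h2 := total_calls_le (r := z ^ 5) (by positivity) (by positivity) hBle hble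
        (Nat.cast_nonneg _) (Nat.cast_nonneg _) hK' hI' (by positivity) (by positivity)
        (by ring) (by ring)
      rw [← hcostB] at h2
      rw [mul_assoc _ (Real.log (1 / ε) ^ 2)]
      refine (h1.trans h2).trans (mul_le_mul_of_nonneg_right
        (mul_le_mul_of_nonneg_right ?_ (by positivity)) hP0)
      exact le_add_of_nonneg_left hcostA0.le
  · have : IsProbabilityMeasure (inputLaw (Dτ τplus θ) D Q) := by unfold inputLaw; infer_instance
    exact measure_ne_top _ _
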